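/- Let $N\ge 1$, let $\Omega\subset\mathbb R^N$ be a bounded open set, let $s\in(0,1)$, and let $p:\mathbb R^N\times\mathbb R^N\to(1,+\infty)$ be a continuous bounded function with $p(x,y)=p(y,x)$ for all $x,y$ and $s\,p^+<N$, where $p^+=\max_{\overline\Omega\times\overline\Omega}p$. Put $K(x,y)=|x-y|^{-(N+sp(x,y))}$, $\bar p(x)=p(x,x)$ and $Q=(\mathbb R^N\times\mathbb R^N)\setminus((\mathbb R^N\setminus\Omega)\times(\mathbb R^N\setminus\Omega))$. Let $X_0=W_0^{K,p(x,y)}(\Omega)$ be the space of measurable functions $u:\mathbb R^N\to\mathbb R$ (modulo equality almost everywhere) such that $\int_\Omega|u|^{\bar p(x)}\,dx<\infty$, $\int_Q \lambda^{-p(x,y)}|u(x)-u(y)|^{p(x,y)}K(x,y)\,dx\,dy<\infty$ for some $\lambda>0$, and $u=0$ a.e. in $\mathbb R^N\setminus\Omega$, with the norm $$\|u\|=\inf\Big\{\lambda>0:\int_\Omega\Big|\frac{u(x)}{\lambda}\Big|^{\bar p(x)}dx\le1\Big\}+\inf\Big\{\lambda>0:\int_Q\frac{|u(x)-u(y)|^{p(x,y)}}{\lambda^{p(x,y)}}K(x,y)\,dx\,dy\le1\Big\}.$$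 Let $f\in X_0^*$, i.e. $f$ is a bounded linear functional on $X_0$. Then there is exactly one $u\in X_0$ such that, for every $\varphi\in X_0$, $$\int_{\mathbb R^{2N}}\frac{|u(x)-u(y)|^{p(x,y)-2}(u(x)-u(y))(\varphi(x)-\varphi(y))}{|x-y|^{N+sp(x,y)}}\,dx\,dy=\langle f,\varphi\rangle ,$$ the integral converging absolutely. -/

import Mathlib

open MeasureTheory Set

noncomputable section

namespace FracVarExp

/-- The Euclidean space `ℝ^N`. -/
abbrev Eucl (N : ℕ) : Type := EuclideanSpace ℝ (Fin N)

variable {N : ℕ}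

/-- A continuous, bounded, symmetric variable exponent `p : ℝ^N × ℝ^N → (1, +∞)`. By compactness
its minimum over `closure Ω × closure Ω` is `> 1` for every bounded `Ω ≠ ∅`. -/
structure IsVariableExponent (p : Eucl N → Eucl N → ℝ) : Prop where
  continuous : Continuous fun z : Eucl N × Eucl N => p z.1 z.2
  one_lt : ∀ x y, 1 < p x y
  bounded : ∃ M : ℝ, ∀ x y, p x y ≤ M
  symm : ∀ x y, p x y = p y x

/-- `p⁺`, the maximum of `p` over `closure Ω × closure Ω`. -/
def pPlus (Ω : Set (Eucl N)) (p : Eucl N → Eucl N → ℝ) : ℝ :=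
  sSup ((fun z : Eucl N × Eucl N => p z.1 z.2) '' (closure Ω ×ˢ closure Ω))

/-- `Q = (ℝ^N × ℝ^N) \ (Ωᶜ × Ωᶜ)`. -/
def crossSet (Ω : Set (Eucl N)) : Set (Eucl N × Eucl N) := (Ωᶜ ×ˢ Ωᶜ)ᶜ

/-- The singular kernel `K(x,y) = |x - y|^{-(N + s p(x,y))}`. (Its value on the diagonal, which is
a null set, is irrelevant.) -/
def singularKernel (s : ℝ) (p : Eucl N → Eucl N → ℝ) (x y : Eucl N) : ℝ :=
  ‖x - y‖ ^ (-((N : ℝ) + s * p x y))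

/-- The modular `∫_Ω |u(x)|^{p(x,x)} / l^{p(x,x)} dx`, with values in `[0, ∞]`. -/
def lebModular (Ω : Set (Eucl N)) (p : Eucl N → Eucl N → ℝ) (u : Eucl N → ℝ) (l : ℝ) : ENNReal :=
  ∫⁻ x in Ω, ENNReal.ofReal (|u x| ^ p x x / l ^ p x x)

/-- The modular `∫_Q |u(x) - u(y)|^{p(x,y)} / l^{p(x,y)} K(x,y) dx dy`, with values in `[0, ∞]`. -/
def gagModular (Ω : Set (Eucl N)) (p K : Eucl N → Eucl N → ℝ) (u : Eucl N → ℝ) (l : ℝ) : ENNReal :=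
  ∫⁻ z in crossSet Ω,
    ENNReal.ofReal (|u z.1 - u z.2| ^ p z.1 z.2 / l ^ p z.1 z.2) * ENNReal.ofReal (K z.1 z.2)

/-- The Luxemburg norm of `L^{p(x,x)}(Ω)`. -/
def lebNorm (Ω : Set (Eucl N)) (p : Eucl N → Eucl N → ℝ) (u : Eucl N → ℝ) : ℝ :=
  sInf {l : ℝ | 0 < l ∧ lebModular Ω p u l ≤ 1}

/-- The Gagliardo type seminorm `[u]_{K,p(x,y)}`. -/
def gagSeminorm (Ω : Set (Eucl N)) (p K : Eucl N → Eucl N → ℝ) (u : Eucl N → ℝ) : ℝ :=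
  sInf {l : ℝ | 0 < l ∧ gagModular Ω p K u l ≤ 1}

/-- The norm `‖u‖_{K,p(x,y)} = ‖u‖_{L^{p(x,x)}(Ω)} + [u]_{K,p(x,y)}` of `W^{K,p(x,y)}(Ω)`. -/
def normK (Ω : Set (Eucl N)) (p K : Eucl N → Eucl N → ℝ) (u : Eucl N → ℝ) : ℝ :=
  lebNorm Ω p u + gagSeminorm Ω p K u

/-- Membership in `W^{K,p(x,y)}(Ω)`: `u` restricted to `Ω` lies in `L^{p(x,x)}(Ω)`, and the
Gagliardo modular of `u / l` is finite for some `l > 0`. -/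
def MemW (Ω : Set (Eucl N)) (p K : Eucl N → Eucl N → ℝ) (u : Eucl N → ℝ) : Prop :=
  (∫⁻ x in Ω, ENNReal.ofReal (|u x| ^ p x x)) < ⊤ ∧ ∃ l : ℝ, 0 < l ∧ gagModular Ω p K u l < ⊤

lemma rpow_add_le {a b q : ℝ} (ha : 0 ≤ a) (hb : 0 ≤ b) (hq : 0 ≤ q) :
    (a + b) ^ q ≤ 2 ^ q * (a ^ q + b ^ q) := by
  have h1 : a + b ≤ 2 * max a b := by
    have := le_max_left a b
    have := le_max_right a b
    linarith
  calc (a + b) ^ q ≤ (2 * max a b) ^ q := Real.rpow_le_rpow (by positivity) h1 hq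
    _ = 2 ^ q * (max a b) ^ q := Real.mul_rpow (by norm_num) (le_max_of_le_left ha)
    _ ≤ 2 ^ q * (a ^ q + b ^ q) := by
        gcongr
        have h2 := Real.rpow_nonneg ha q
        have h3 := Real.rpow_nonneg hb q
        rcases max_choice a b with h | h <;> rw [h] <;> linarith

lemma rpow_div_le {a b c l q M : ℝ} (ha : 0 ≤ a) (hb : 0 ≤ b) (hc : 0 ≤ c) (hl : 0 < l)
    (hq : 0 ≤ q) (hM : q ≤ M) (h : c ≤ a + b) :
    c ^ q / l ^ q ≤ 2 ^ M * (a ^ q / l ^ q + b ^ q / l ^ q) := by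
  have h1 : c ^ q ≤ 2 ^ M * (a ^ q + b ^ q) :=
    (Real.rpow_le_rpow hc h hq).trans ((rpow_add_le ha hb hq).trans (by
      gcongr
      norm_num))
  calc c ^ q / l ^ q ≤ (2 ^ M * (a ^ q + b ^ q)) / l ^ q := by gcongr
    _ = _ := by ring

lemma ae_pair {P : Eucl N → Prop} (h : ∀ᵐ x : Eucl N, P x) (S : Set (Eucl N × Eucl N)) :
    ∀ᵐ z ∂(volume : Measure (Eucl N × Eucl N)).restrict S, P z.1 ∧ P z.2 := by
  apply ae_restrict_of_ae
  rw [Measure.volume_eq_prod]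
  filter_upwards [Measure.quasiMeasurePreserving_fst.ae h,
    Measure.quasiMeasurePreserving_snd.ae h] with z h1 h2 using ⟨h1, h2⟩

variable {Ω : Set (Eucl N)} {p : Eucl N → Eucl N → ℝ}

lemma gagModular_anti (hp : IsVariableExponent p) (K : Eucl N → Eucl N → ℝ) (u : Eucl N → ℝ)
    {l l' : ℝ} (hl : 0 < l) (hll : l ≤ l') : gagModular Ω p K u l' ≤ gagModular Ω p K u l := by
  refine lintegral_mono fun z => ?_
  have := hp.one_lt z.1 z.2
  have h1 : l ^ p z.1 z.2 ≤ l' ^ p z.1 z.2 := Real.rpow_le_rpow hl.le hll (by linarith)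
  have h2 : 0 < l ^ p z.1 z.2 := Real.rpow_pos_of_pos hl _
  have h3 : 0 ≤ |u z.1 - u z.2| ^ p z.1 z.2 := by positivity
  dsimp only
  gcongr

lemma MemW.zero (hp : IsVariableExponent p) (K : Eucl N → Eucl N → ℝ) :
    MemW Ω p K ((0 : Eucl N →ₘ[volume] ℝ) : Eucl N → ℝ) := by
  have h0 : ((0 : Eucl N →ₘ[volume] ℝ) : Eucl N → ℝ) =ᵐ[volume] 0 := AEEqFun.coeFn_zero
  refine ⟨?_, 1, one_pos, ?_⟩
  · rw [lintegral_congr_ae (g := fun _ => 0)]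
    · simp
    · filter_upwards [ae_restrict_of_ae h0] with x hx
      have := hp.one_lt x x
      simp [hx, Real.zero_rpow (by linarith : p x x ≠ 0)]
  · rw [gagModular, lintegral_congr_ae (g := fun _ => 0)]
    · simp
    · filter_upwards [ae_pair h0 _] with z hz
      have := hp.one_lt z.1 z.2
      simp [hz.1, hz.2, Real.zero_rpow (by linarith : p z.1 z.2 ≠ 0)]

lemma ofReal_rpow_measurable (hp : IsVariableExponent p) (u : Eucl N →ₘ[volume] ℝ) :
    Measurable fun x => ENNReal.ofReal (|u x| ^ p x x) := by
  have h1 : Measurable fun x => p x x :=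
    (hp.continuous.comp (continuous_id.prodMk continuous_id)).measurable
  have h2 : Measurable u := u.measurable
  exact ((measurable_norm.comp h2).pow h1).ennreal_ofReal

lemma gag_measurable (hp : IsVariableExponent p) (u : Eucl N →ₘ[volume] ℝ) (l : ℝ) :
    Measurable fun z : Eucl N × Eucl N =>
      ENNReal.ofReal (|u z.1 - u z.2| ^ p z.1 z.2 / l ^ p z.1 z.2) := by
  have h1 : Measurable fun z : Eucl N × Eucl N => p z.1 z.2 := hp.continuous.measurable
  have h2 : Measurable u := u.measurable
  have h3 : Measurable fun z : Eucl N × Eucl N => u z.1 - u z.2 :=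
    (h2.comp measurable_fst).sub (h2.comp measurable_snd)
  exact (((measurable_norm.comp h3).pow h1).div (measurable_const.pow h1)).ennreal_ofReal

lemma MemW.add (hp : IsVariableExponent p) {K : Eucl N → Eucl N → ℝ}
    (hK : Measurable fun z : Eucl N × Eucl N => K z.1 z.2)
    {u v : Eucl N →ₘ[volume] ℝ} (hu : MemW Ω p K u) (hv : MemW Ω p K v) :
    MemW Ω p K ((u + v : Eucl N →ₘ[volume] ℝ) : Eucl N → ℝ) := by
  obtain ⟨M, hM⟩ := hp.bounded
  have hadd : ∀ᵐ x, (u + v : Eucl N →ₘ[volume] ℝ) x = u x + v x := AEEqFun.coeFn_add u v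
  obtain ⟨hu1, l, hl, hu2⟩ := hu
  obtain ⟨hv1, l', hl', hv2⟩ := hv
  have hC : (ENNReal.ofReal (2 ^ M)) ≠ ⊤ := ENNReal.ofReal_ne_top
  refine ⟨?_, max l l', lt_max_of_lt_left hl, ?_⟩
  · refine lt_of_le_of_lt (lintegral_mono_ae (g := fun x => ENNReal.ofReal (2 ^ M) *
      (ENNReal.ofReal (|u x| ^ p x x) + ENNReal.ofReal (|v x| ^ p x x))) ?_) ?_
    · filter_upwards [ae_restrict_of_ae hadd] with x hx
      have h0 := hp.one_lt x x
      rw [← ENNReal.ofReal_add (by positivity) (by positivity),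
        ← ENNReal.ofReal_mul (by positivity), hx]
      apply ENNReal.ofReal_le_ofReal
      simpa using rpow_div_le (abs_nonneg (u x)) (abs_nonneg (v x)) (abs_nonneg (u x + v x))
        one_pos (by linarith : 0 ≤ p x x) (hM x x) (abs_add_le _ _)
    · rw [lintegral_const_mul' _ _ hC, lintegral_add_left (ofReal_rpow_measurable hp u)]
      exact ENNReal.mul_lt_top hC.lt_top (ENNReal.add_lt_top.2 ⟨hu1, hv1⟩)
  · set L := max l l' with hL
    have hLpos : 0 < L := lt_max_of_lt_left hl
    have hu3 := (gagModular_anti (Ω := Ω) hp K u hl (le_max_left l l')).trans_lt hu2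
    have hv3 := (gagModular_anti (Ω := Ω) hp K v hl' (le_max_right l l')).trans_lt hv2
    refine lt_of_le_of_lt (lintegral_mono_ae (g := fun z => ENNReal.ofReal (2 ^ M) *
      (ENNReal.ofReal (|u z.1 - u z.2| ^ p z.1 z.2 / L ^ p z.1 z.2) * ENNReal.ofReal (K z.1 z.2) +
       ENNReal.ofReal (|v z.1 - v z.2| ^ p z.1 z.2 / L ^ p z.1 z.2) * ENNReal.ofReal (K z.1 z.2)))
       ?_) ?_
    · filter_upwards [ae_pair hadd _] with z hz
      have h0 := hp.one_lt z.1 z.2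
      rw [← add_mul, ← mul_assoc, ← ENNReal.ofReal_add (by positivity) (by positivity),
        ← ENNReal.ofReal_mul (p := 2 ^ M) (by positivity), hz.1, hz.2]
      refine mul_le_mul_left (ENNReal.ofReal_le_ofReal ?_) _
      refine rpow_div_le (abs_nonneg _) (abs_nonneg _) (abs_nonneg _) hLpos (by linarith)
        (hM z.1 z.2) ?_
      have : u z.1 + v z.1 - (u z.2 + v z.2) = (u z.1 - u z.2) + (v z.1 - v z.2) := by ring
      rw [this]
      exact abs_add_le _ _
    · rw [lintegral_const_mul' _ _ hC,
        lintegral_add_left (f := fun z : Eucl N × Eucl N =>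
          ENNReal.ofReal (|u z.1 - u z.2| ^ p z.1 z.2 / L ^ p z.1 z.2) * ENNReal.ofReal (K z.1 z.2))
          ((gag_measurable hp u L).mul hK.ennreal_ofReal)]
      exact ENNReal.mul_lt_top hC.lt_top (ENNReal.add_lt_top.2 ⟨hu3, hv3⟩)

lemma abs_mul_rpow_le {c t q M : ℝ} (hq : 0 ≤ q) (hM : q ≤ M) :
    |c * t| ^ q ≤ (1 + |c|) ^ M * |t| ^ q := by
  rw [abs_mul, Real.mul_rpow (abs_nonneg c) (abs_nonneg t)]
  gcongr
  calc |c| ^ q ≤ (1 + |c|) ^ q := Real.rpow_le_rpow (abs_nonneg c) (by linarith) hq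
    _ ≤ (1 + |c|) ^ M := Real.rpow_le_rpow_of_exponent_le (by linarith [abs_nonneg c]) hM

lemma MemW.smul (hp : IsVariableExponent p) {K : Eucl N → Eucl N → ℝ} (c : ℝ)
    {u : Eucl N →ₘ[volume] ℝ} (hu : MemW Ω p K u) :
    MemW Ω p K ((c • u : Eucl N →ₘ[volume] ℝ) : Eucl N → ℝ) := by
  obtain ⟨M, hM⟩ := hp.bounded
  have hsm : ∀ᵐ x, (c • u : Eucl N →ₘ[volume] ℝ) x = c * u x := AEEqFun.coeFn_smul c u
  obtain ⟨hu1, l, hl, hu2⟩ := hu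
  have hC : (ENNReal.ofReal ((1 + |c|) ^ M)) ≠ ⊤ := ENNReal.ofReal_ne_top
  refine ⟨?_, l, hl, ?_⟩
  · refine lt_of_le_of_lt (lintegral_mono_ae (g := fun x => ENNReal.ofReal ((1 + |c|) ^ M) *
      ENNReal.ofReal (|u x| ^ p x x)) ?_) ?_
    · filter_upwards [ae_restrict_of_ae hsm] with x hx
      have h0 := hp.one_lt x x
      rw [← ENNReal.ofReal_mul (by positivity), hx]
      exact ENNReal.ofReal_le_ofReal (abs_mul_rpow_le (by linarith) (hM x x))
    · rw [lintegral_const_mul' _ _ hC]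
      exact ENNReal.mul_lt_top hC.lt_top hu1
  · refine lt_of_le_of_lt (lintegral_mono_ae (g := fun z => ENNReal.ofReal ((1 + |c|) ^ M) *
      (ENNReal.ofReal (|u z.1 - u z.2| ^ p z.1 z.2 / l ^ p z.1 z.2) * ENNReal.ofReal (K z.1 z.2)))
       ?_) ?_
    · filter_upwards [ae_pair hsm _] with z hz
      have h0 := hp.one_lt z.1 z.2
      rw [← mul_assoc, ← ENNReal.ofReal_mul (p := (1 + |c|) ^ M) (by positivity), hz.1, hz.2,
        ← mul_sub, ← mul_div_assoc]
      refine mul_le_mul_left (ENNReal.ofReal_le_ofReal ?_) _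
      gcongr
      exact abs_mul_rpow_le (by linarith) (hM z.1 z.2)
    · rw [lintegral_const_mul' _ _ hC]
      exact ENNReal.mul_lt_top hC.lt_top hu2

lemma singularKernel_measurable (hp : IsVariableExponent p) (s : ℝ) :
    Measurable fun z : Eucl N × Eucl N => singularKernel s p z.1 z.2 := by
  have h1 : Measurable fun z : Eucl N × Eucl N => p z.1 z.2 := hp.continuous.measurable
  have h2 : Measurable fun z : Eucl N × Eucl N => ‖z.1 - z.2‖ := by fun_prop
  exact h2.pow ((h1.const_mul s).const_add (N : ℝ)).neg

/-- The space `W_0^{K,p(x,y)}(Ω)` for a measurable kernel `K`: the classes (modulo equality almost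
everywhere) of measurable functions `u : ℝ^N → ℝ` in `W^{K,p(x,y)}(Ω)` that vanish almost everywhere
outside `Ω`. -/
def W0 (Ω : Set (Eucl N)) {p : Eucl N → Eucl N → ℝ} (hp : IsVariableExponent p)
    (K : Eucl N → Eucl N → ℝ) (hK : Measurable fun z : Eucl N × Eucl N => K z.1 z.2) :
    Submodule ℝ (Eucl N →ₘ[volume] ℝ) where
  carrier := {u | MemW Ω p K u ∧ ∀ᵐ x, x ∉ Ω → u x = 0}
  zero_mem' := by
    refine ⟨MemW.zero hp K, ?_⟩
    have h0 : ((0 : Eucl N →ₘ[volume] ℝ) : Eucl N → ℝ) =ᵐ[volume] 0 := AEEqFun.coeFn_zero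
    filter_upwards [h0] with x hx _ using hx
  add_mem' := by
    rintro u v ⟨hu, hu0⟩ ⟨hv, hv0⟩
    refine ⟨hu.add hp hK hv, ?_⟩
    filter_upwards [hu0, hv0, AEEqFun.coeFn_add u v] with x h1 h2 h3 hx
    rw [h3, Pi.add_apply, h1 hx, h2 hx, add_zero]
  smul_mem' := by
    rintro c u ⟨hu, hu0⟩
    refine ⟨hu.smul hp c, ?_⟩
    filter_upwards [hu0, AEEqFun.coeFn_smul c u] with x h1 h2 hx
    rw [h2, Pi.smul_apply, h1 hx, smul_zero]

/-- The space `X_0 = W_0^{K,p(x,y)}(Ω)` for `K(x,y) = |x - y|^{-(N + s p(x,y))}`. -/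
def X0 (Ω : Set (Eucl N)) (s : ℝ) {p : Eucl N → Eucl N → ℝ} (hp : IsVariableExponent p) :
    Submodule ℝ (Eucl N →ₘ[volume] ℝ) :=
  W0 Ω hp (singularKernel s p) (singularKernel_measurable hp s)

/-- The dual space `X_0^*`: linear functionals on `X_0` that are bounded with respect to the norm
`‖·‖_{K,p(x,y)}`. -/
def IsDual {s : ℝ} {hp : IsVariableExponent p} (f : X0 Ω s hp →ₗ[ℝ] ℝ) : Prop :=
  ∃ C : ℝ, ∀ v : X0 Ω s hp, |f v| ≤ C * normK Ω p (singularKernel s p) (v : Eucl N →ₘ[volume] ℝ)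

/-- The integrand
`|u(x)-u(y)|^{p(x,y)-2} (u(x)-u(y)) (φ(x)-φ(y)) / |x-y|^{N + s p(x,y)}`. -/
def weakIntegrand (s : ℝ) (p : Eucl N → Eucl N → ℝ) (u φ : Eucl N → ℝ)
    (z : Eucl N × Eucl N) : ℝ :=
  |u z.1 - u z.2| ^ (p z.1 z.2 - 2) * (u z.1 - u z.2) * (φ z.1 - φ z.2)
    / ‖z.1 - z.2‖ ^ ((N : ℝ) + s * p z.1 z.2)

/-- `u ∈ X_0` solves the weak equation with right-hand side `f`: for every test function
`φ ∈ X_0` the integral over `ℝ^N × ℝ^N` converges absolutely and equals `⟨f, φ⟩`. -/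
def IsWeakSolution {s : ℝ} {hp : IsVariableExponent p} (f : X0 Ω s hp →ₗ[ℝ] ℝ)
    (u : X0 Ω s hp) : Prop :=
  ∀ φ : X0 Ω s hp,
    Integrable (weakIntegrand s p (u : Eucl N →ₘ[volume] ℝ) (φ : Eucl N →ₘ[volume] ℝ)) ∧
    ∫ z, weakIntegrand s p (u : Eucl N →ₘ[volume] ℝ) (φ : Eucl N →ₘ[volume] ℝ) z = f φ

end FracVarExp

end

open MeasureTheory Set Filter Topology

noncomputable section

namespace FracVarExp

/-! The equation is the Euler–Lagrange equation of the energy `J u = ∫ |u(x) - u(y)|^p / p dν - f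
u`, with `dν = K dx dy`. The direct method gives a minimizer, differentiating along lines shows that
it solves the equation, and strict monotonicity of `t ↦ |t|^(p-2) t` gives uniqueness.

The difficulty is that `p` may approach `1` at infinity, so neither coercivity nor uniform convexity
is uniform over all pairs. Both are uniform on the set `{p ≥ q}`, where `q > 1` is the minimum of
`p` on pairs from a ball somewhat larger than `Ω`. Everything is therefore measured by the upper
modular, the part of the modular over `{p ≥ q}`. `exists_modular_bound` shows that it controls the
full norm, in three stages. The upper modular bounds `u` in `L¹`, by comparison with an exterior
ball where `u = 0`. The `L¹` bound and the singularity of the kernel bound `∫ |u|^p(x,x)`. That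
integral bounds the pairs with `p < q`, which are far from the diagonal.

Uniform convexity makes minimizing sequences Cauchy for the upper modular, hence in `L¹`. An a.e.
convergent subsequence and Fatou's lemma then give the minimizer, so neither reflexivity of the
space nor a compact embedding is needed. `ModularSystem` isolates the variational half of the
argument. -/

/-! ### Scalar inequalities for powers with varying exponent -/

/-- Strict midpoint convexity of `t ↦ |t| ^ p` for `p > 1`. -/
lemma abs_midpoint_rpow_lt {p a b : ℝ} (hp : 1 < p) (hab : a ≠ b) :
    |(a + b) / 2| ^ p < (|a| ^ p + |b| ^ p) / 2 := by
  by_cases h : |a| = |b|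
  · rcases abs_eq_abs.1 h with h' | h'
    · exact absurd h' hab
    · have hb : b ≠ 0 := by
        rintro rfl
        exact hab (by simpa using h')
      have h1 : 0 < |b| ^ p := Real.rpow_pos_of_pos (abs_pos.2 hb) _
      have h2 : (a + b) / 2 = 0 := by rw [h']; ring
      rw [h2, abs_zero, Real.zero_rpow (by linarith), h]
      linarith
  · have h1 := (strictConvexOn_rpow hp).2 (abs_nonneg a) (abs_nonneg b) h
      (by norm_num : (0 : ℝ) < 1 / 2) (by norm_num : (0 : ℝ) < 1 / 2) (by norm_num)
    simp only [smul_eq_mul] at h1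
    have h2 : |(a + b) / 2| ≤ 1 / 2 * |a| + 1 / 2 * |b| := by
      rw [abs_div, abs_two]
      linarith [abs_add_le a b]
    have h3 := Real.rpow_le_rpow (abs_nonneg _) h2 (by linarith : 0 ≤ p)
    linarith

lemma abs_midpoint_rpow_le {p a b : ℝ} (hp : 1 < p) :
    |(a + b) / 2| ^ p ≤ (|a| ^ p + |b| ^ p) / 2 := by
  by_cases h : a = b
  · subst h; simp
  · exact (abs_midpoint_rpow_lt hp h).le

lemma continuousOn_abs_rpow {α : Type*} [TopologicalSpace α] {s : Set α} {f g : α → ℝ}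
    (hf : ContinuousOn f s) (hg : ContinuousOn g s) (h : ∀ x ∈ s, 0 < g x) :
    ContinuousOn (fun x => |f x| ^ g x) s :=
  hf.abs.rpow hg fun x hx => Or.inr (h x hx)

/-- The powers `|t| ^ p` with `p` in a compact subinterval of `(1, ∞)` are uniformly convex,
uniformly in `p`. -/
lemma exists_uniform_convexity {q M ε : ℝ} (hq : 1 < q) (hε : 0 < ε) :
    ∃ C : ℝ, 0 ≤ C ∧ ∀ p a b : ℝ, q ≤ p → p ≤ M →
      |a - b| ^ p ≤ ε * (|a| ^ p + |b| ^ p) +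
        C * ((|a| ^ p + |b| ^ p) / 2 - |(a + b) / 2| ^ p) := by
  set D : Set (ℝ × ℝ × ℝ) := Icc q M ×ˢ (Icc (-1) 1 ×ˢ Icc (-1) 1) with hD
  have hDc : IsCompact D := isCompact_Icc.prod (isCompact_Icc.prod isCompact_Icc)
  have hpos : ∀ w ∈ D, 0 < w.1 := fun w hw => by
    have := hw.1.1
    linarith
  have c1 : ContinuousOn (fun w : ℝ × ℝ × ℝ => |w.2.1| ^ w.1) D :=
    continuousOn_abs_rpow (by fun_prop) (by fun_prop) hpos
  have c2 : ContinuousOn (fun w : ℝ × ℝ × ℝ => |w.2.2| ^ w.1) D :=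
    continuousOn_abs_rpow (by fun_prop) (by fun_prop) hpos
  have c3 : ContinuousOn (fun w : ℝ × ℝ × ℝ => |w.2.1 - w.2.2| ^ w.1) D :=
    continuousOn_abs_rpow (by fun_prop) (by fun_prop) hpos
  have c4 : ContinuousOn (fun w : ℝ × ℝ × ℝ => |(w.2.1 + w.2.2) / 2| ^ w.1) D :=
    continuousOn_abs_rpow (by fun_prop) (by fun_prop) hpos
  have c5 : ContinuousOn (fun w : ℝ × ℝ × ℝ => max |w.2.1| |w.2.2|) D := by fun_prop
  set F : ℝ × ℝ × ℝ → ℝ := fun w => |w.2.1 - w.2.2| ^ w.1 - ε * (|w.2.1| ^ w.1 + |w.2.2| ^ w.1)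
  set G : ℝ × ℝ × ℝ → ℝ :=
    fun w => (|w.2.1| ^ w.1 + |w.2.2| ^ w.1) / 2 - |(w.2.1 + w.2.2) / 2| ^ w.1
  have hF : ContinuousOn F D := c3.sub (continuousOn_const.mul (c1.add c2))
  have hG : ContinuousOn G D := ((c1.add c2).div_const 2).sub c4
  -- Only points with `F ≥ 0` need a contribution from `G`. On them `a ≠ b`, since `a = b` and `max
  -- |a| |b| = 1` would give `F = -2ε < 0`; so `G` is positive on the compact set `D'`.
  set D' : Set (ℝ × ℝ × ℝ) :=
    D ∩ (fun w => (F w, max |w.2.1| |w.2.2|)) ⁻¹' (Ici 0 ×ˢ {1}) with hD'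
  have hD'c : IsCompact D' :=
    hDc.of_isClosed_subset ((hF.prodMk c5).preimage_isClosed_of_isClosed hDc.isClosed
      (isClosed_Ici.prod isClosed_singleton)) inter_subset_left
  have key : ∃ C : ℝ, 0 ≤ C ∧ ∀ w ∈ D, max |w.2.1| |w.2.2| = 1 → F w ≤ C * G w := by
    have hGnn : ∀ w ∈ D, 0 ≤ G w := fun w hw =>
      sub_nonneg.2 (abs_midpoint_rpow_le (lt_of_lt_of_le hq hw.1.1))
    rcases D'.eq_empty_or_nonempty with he | hne
    · refine ⟨0, le_rfl, fun w hw h1 => ?_⟩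
      by_contra hcon
      have : w ∈ D' := ⟨hw, by simp only [zero_mul, not_le] at hcon; exact hcon.le, h1⟩
      rw [he] at this
      exact this
    · obtain ⟨w0, hw0, hmin⟩ := hD'c.exists_isMinOn hne (hG.mono inter_subset_left)
      obtain ⟨w1, hw1, hmax⟩ := hD'c.exists_isMaxOn hne (hF.mono inter_subset_left)
      have hG0 : 0 < G w0 := by
        refine sub_pos.2 (abs_midpoint_rpow_lt (lt_of_lt_of_le hq hw0.1.1.1) fun hab => ?_)
        have h1 : (0 : ℝ) ≤ F w0 := hw0.2.1
        have h2 : max |w0.2.1| |w0.2.2| = 1 := hw0.2.2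
        simp only [F, hab, sub_self, abs_zero, Real.zero_rpow (hpos w0 hw0.1).ne'] at h1
        rw [hab, max_self] at h2
        rw [h2, Real.one_rpow] at h1
        linarith
      have hF1 : 0 ≤ F w1 := hw1.2.1
      -- Maximum of `F` over minimum of `G` on `D'`; off `D'` one has `F < 0 ≤ G`.
      refine ⟨F w1 / G w0, div_nonneg hF1 hG0.le, fun w hw h1 => ?_⟩
      by_cases h0 : 0 ≤ F w
      · have hw' : w ∈ D' := ⟨hw, h0, h1⟩
        have h2 : F w ≤ F w1 := hmax hw'
        have h3 : G w0 ≤ G w := hmin hw'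
        calc F w ≤ F w1 := h2
          _ = F w1 / G w0 * G w0 := by field_simp
          _ ≤ F w1 / G w0 * G w := by gcongr
      · have := hGnn w hw
        have : 0 ≤ F w1 / G w0 * G w := mul_nonneg (div_nonneg hF1 hG0.le) this
        linarith
  obtain ⟨C, hC, hkey⟩ := key
  refine ⟨C, hC, fun p a b hqp hpM => ?_⟩
  have hp0 : 0 < p := by linarith
  -- All terms are homogeneous of degree `p` in `(a, b)`, so dividing by `r` reduces to `max |a| |b|
  -- = 1`.
  set r := max |a| |b| with hr
  rcases (le_max_of_le_left (abs_nonneg a) : 0 ≤ r).eq_or_lt with h0 | h0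
  · have ha : a = 0 := by
      have := le_max_left |a| |b|
      exact abs_nonpos_iff.1 (by linarith)
    have hb : b = 0 := by
      have := le_max_right |a| |b|
      exact abs_nonpos_iff.1 (by linarith)
    simp [ha, hb, Real.zero_rpow hp0.ne']
  · have hmul : ∀ t : ℝ, |t| ^ p = r ^ p * |t / r| ^ p := fun t => by
      rw [← Real.mul_rpow h0.le (abs_nonneg _), abs_div, abs_of_pos h0]
      congr 1
      field_simp
    have ha1 : |a / r| ≤ 1 := by
      rw [abs_div, abs_of_pos h0, div_le_one h0]; exact le_max_left _ _
    have hb1 : |b / r| ≤ 1 := by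
      rw [abs_div, abs_of_pos h0, div_le_one h0]; exact le_max_right _ _
    have h1 : max |a / r| |b / r| = 1 := by
      rw [abs_div, abs_div, abs_of_pos h0, max_div_div_right h0.le, ← hr, div_self h0.ne']
    have h2 := hkey (p, a / r, b / r) ⟨⟨hqp, hpM⟩, abs_le.1 ha1, abs_le.1 hb1⟩ h1
    simp only [F, G] at h2
    have hrp : 0 < r ^ p := Real.rpow_pos_of_pos h0 _
    have h3 := mul_le_mul_of_nonneg_left h2 hrp.le
    rw [hmul a, hmul b, hmul (a - b), hmul ((a + b) / 2)]
    have e1 : (a - b) / r = a / r - b / r := by ring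
    have e2 : (a + b) / 2 / r = (a / r + b / r) / 2 := by ring
    rw [e1, e2]
    linarith

lemma abs_rpow_sub_two_mul_self_lt {p a b : ℝ} (hp : 1 < p) (hab : a < b) :
    |a| ^ (p - 2) * a < |b| ^ (p - 2) * b := by
  have hpos : ∀ t : ℝ, 0 < t → |t| ^ (p - 2) * t = t ^ (p - 1) := fun t ht => by
    rw [abs_of_pos ht, ← Real.rpow_add_one ht.ne']; ring_nf
  have hneg : ∀ t : ℝ, t < 0 → |t| ^ (p - 2) * t = -(-t) ^ (p - 1) := fun t ht => by
    have := hpos (-t) (by linarith)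
    rw [abs_neg] at this
    linarith
  rcases lt_trichotomy b 0 with hb | hb | hb
  · rw [hneg a (by linarith), hneg b hb]
    have := Real.rpow_lt_rpow (by linarith : 0 ≤ -b) (by linarith : -b < -a)
      (by linarith : 0 < p - 1)
    linarith
  · subst hb
    rw [hneg a hab, mul_zero]
    have := Real.rpow_pos_of_pos (by linarith : 0 < -a) (p - 1)
    linarith
  · rw [hpos b hb]
    have h1 := Real.rpow_pos_of_pos hb (p - 1)
    rcases lt_trichotomy a 0 with ha | ha | ha
    · rw [hneg a ha]
      have := Real.rpow_pos_of_pos (by linarith : 0 < -a) (p - 1)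
      linarith
    · subst ha; simpa using h1
    · rw [hpos a ha]
      exact Real.rpow_lt_rpow ha.le hab (by linarith)

lemma monotone_gap_pos {p a b : ℝ} (hp : 1 < p) (hab : a ≠ b) :
    0 < (|a| ^ (p - 2) * a - |b| ^ (p - 2) * b) * (a - b) := by
  rcases lt_or_gt_of_ne hab with h | h
  · have := abs_rpow_sub_two_mul_self_lt hp h
    exact mul_pos_of_neg_of_neg (by linarith) (by linarith)
  · have := abs_rpow_sub_two_mul_self_lt hp h
    exact mul_pos (by linarith) (by linarith)

/-- Replaces Young's inequality: `c = max |a| |b|` gives integrability of the weak integrand, and `c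
= |a| + |b|` the domination needed to differentiate the energy. -/
lemma abs_rpow_sub_two_mul_mul_le {p a b c : ℝ} (hp : 1 < p) (ha : |a| ≤ c) (hb : |b| ≤ c) :
    |(|a| ^ (p - 2) * a * b)| ≤ c ^ p := by
  have h0 : 0 ≤ c := (abs_nonneg a).trans ha
  rcases (abs_nonneg a).eq_or_lt with h | h
  · rw [abs_eq_zero.1 h.symm]
    simpa using Real.rpow_nonneg h0 p
  · have hc : 0 < c := h.trans_le ha
    rw [abs_mul, abs_mul, abs_of_nonneg (Real.rpow_nonneg (abs_nonneg a) _),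
      ← Real.rpow_add_one h.ne']
    calc |a| ^ (p - 2 + 1) * |b| ≤ c ^ (p - 2 + 1) * c := by
          gcongr
          linarith
      _ = c ^ p := by
          rw [← Real.rpow_add_one hc.ne']; ring_nf

/-- If `t > ε`, then `t = t^(1-p) t^p` and `t^(1-p) ≤ ε^(1-p) ≤ ε^(1-M)`. The constant does not
depend on `p`, and the free term `ε` makes `L¹` norms small when modulars are. -/
lemma le_add_rpow_mul {t ε p M : ℝ} (ht : 0 ≤ t) (hε : 0 < ε) (hε1 : ε ≤ 1) (hp : 1 ≤ p)
    (hM : p ≤ M) : t ≤ ε + ε ^ (1 - M) * t ^ p := by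
  have h2 := Real.rpow_pos_of_pos hε (1 - M)
  have h3 := Real.rpow_nonneg ht p
  by_cases h : t ≤ ε
  · have := mul_nonneg h2.le h3
    linarith
  · push Not at h
    have ht' : 0 < t := hε.trans h
    have h1 : t ^ (1 - p) ≤ ε ^ (1 - M) :=
      (Real.rpow_le_rpow_of_nonpos hε h.le (by linarith)).trans
        (Real.rpow_le_rpow_of_exponent_ge hε hε1 (by linarith))
    have h4 : t = t ^ (1 - p) * t ^ p := by
      rw [← Real.rpow_add ht']; simp
    have h5 := mul_le_mul_of_nonneg_right h1 h3
    linarith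

/-! ### The direct method for abstract modular systems -/

/-- A linear family `T u` of measurable functions whose modulars `∫ |T u| ^ P` with variable
exponent `1 < P ≤ M` are finite. -/
structure ModularSystem {X Z : Type*} [AddCommGroup X] [Module ℝ X] [MeasurableSpace Z]
    (μ : Measure Z) (T : X → Z → ℝ) (P : Z → ℝ) (M : ℝ) : Prop where
  measurable_exponent : Measurable P
  one_lt : ∀ z, 1 < P z
  le_bound : ∀ z, P z ≤ M
  measurable : ∀ u, Measurable (T u)
  add : ∀ u v, ∀ᵐ z ∂μ, T (u + v) z = T u z + T v z
  smul : ∀ (c : ℝ) u, ∀ᵐ z ∂μ, T (c • u) z = c * T u z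
  integrable : ∀ u, Integrable (fun z => |T u z| ^ P z) μ

/-- The modular of `u` over the set where the exponent is at least `q`. -/
def upperModular {X Z : Type*} [MeasurableSpace Z]
    (μ : Measure Z) (T : X → Z → ℝ) (P : Z → ℝ) (q : ℝ) (u : X) : ℝ :=
  ∫ z in {z | q ≤ P z}, |T u z| ^ P z ∂μ

/-- The energy `∫ |T u| ^ P / P`. -/
def modularEnergy {X Z : Type*} [MeasurableSpace Z]
    (μ : Measure Z) (T : X → Z → ℝ) (P : Z → ℝ) (u : X) : ℝ :=
  ∫ z, (P z)⁻¹ * |T u z| ^ P z ∂μ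

/-- Fatou's lemma for real integrals. It supplies the lower semicontinuity of the energy and of the
upper modular. -/
lemma integral_le_of_ae_tendsto {Z : Type*} [MeasurableSpace Z] {μ : Measure Z}
    {g : ℕ → Z → ℝ} {h : Z → ℝ} {c : ℝ} (hg : ∀ k z, 0 ≤ g k z) (hgi : ∀ k, Integrable (g k) μ)
    (hgm : ∀ k, Measurable (g k)) (hh : ∀ z, 0 ≤ h z) (hhm : Measurable h)
    (hlim : ∀ᵐ z ∂μ, Tendsto (fun k => g k z) atTop (𝓝 (h z)))
    (hc : ∀ᶠ k in atTop, ∫ z, g k z ∂μ ≤ c) : ∫ z, h z ∂μ ≤ c := by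
  have hc0 : 0 ≤ c := by
    obtain ⟨k, hk⟩ := hc.exists
    exact (integral_nonneg (hg k)).trans hk
  rw [integral_eq_lintegral_of_nonneg_ae (Eventually.of_forall hh) hhm.aestronglyMeasurable]
  refine ENNReal.toReal_le_of_le_ofReal hc0 ?_
  calc ∫⁻ z, ENNReal.ofReal (h z) ∂μ
      = ∫⁻ z, liminf (fun k => ENNReal.ofReal (g k z)) atTop ∂μ := by
        refine lintegral_congr_ae ?_
        filter_upwards [hlim] with z hz
        exact ((ENNReal.continuous_ofReal.tendsto _).comp hz).liminf_eq.symm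
    _ ≤ liminf (fun k => ∫⁻ z, ENNReal.ofReal (g k z) ∂μ) atTop :=
        lintegral_liminf_le fun k => (hgm k).ennreal_ofReal
    _ ≤ ENNReal.ofReal c := by
        refine liminf_le_of_le (by isBoundedDefault) fun b hb => ?_
        obtain ⟨k, hk1, hk2⟩ := (hb.and hc).exists
        refine hk1.trans ?_
        rw [← ofReal_integral_eq_lintegral_ofReal (hgi k) (Eventually.of_forall (hg k))]
        exact ENNReal.ofReal_le_ofReal hk2

namespace ModularSystem

variable {X Z : Type*} [AddCommGroup X] [Module ℝ X] [MeasurableSpace Z]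
  {μ : Measure Z} {T : X → Z → ℝ} {P : Z → ℝ} {M : ℝ}

lemma sub (H : ModularSystem μ T P M) (u v : X) :
    ∀ᵐ z ∂μ, T (u - v) z = T u z - T v z := by
  filter_upwards [H.add u ((-1 : ℝ) • v), H.smul (-1) v] with z h1 h2
  rw [sub_eq_add_neg, ← neg_one_smul ℝ v, h1, h2]
  ring

lemma measurable_rpow (H : ModularSystem μ T P M) {g : Z → ℝ} (hg : Measurable g) :
    Measurable fun z => |g z| ^ P z :=
  (measurable_norm.comp hg).pow H.measurable_exponent

lemma measurableSet_upper (H : ModularSystem μ T P M) (q : ℝ) : MeasurableSet {z | q ≤ P z} :=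
  measurableSet_le measurable_const H.measurable_exponent

lemma integrable_energy (H : ModularSystem μ T P M) (u : X) :
    Integrable (fun z => (P z)⁻¹ * |T u z| ^ P z) μ := by
  refine (H.integrable u).mono
    (H.measurable_exponent.inv.mul (H.measurable_rpow (H.measurable u))).aestronglyMeasurable
    (Eventually.of_forall fun z => ?_)
  have h1 := H.one_lt z
  have h2 : 0 ≤ |T u z| ^ P z := by positivity
  have h3 : (P z)⁻¹ ≤ 1 := inv_le_one_of_one_le₀ h1.le
  have h4 : 0 ≤ (P z)⁻¹ := by positivity
  rw [Real.norm_of_nonneg (mul_nonneg h4 h2), Real.norm_of_nonneg h2]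
  exact mul_le_of_le_one_left h2 h3

lemma upperModular_nonneg {X : Type*} {T : X → Z → ℝ} (q : ℝ) (u : X) : 0 ≤ upperModular μ T P q u :=
  integral_nonneg fun _ => by positivity

lemma upperModular_le_energy (H : ModularSystem μ T P M) (q : ℝ) (u : X) :
    upperModular μ T P q u ≤ M * modularEnergy μ T P u := by
  have hnn : ∀ z, 0 ≤ |T u z| ^ P z := fun z => by positivity
  rw [modularEnergy, ← integral_const_mul]
  refine (setIntegral_le_integral (H.integrable u) (Eventually.of_forall hnn)).trans
    (integral_mono (H.integrable u) ((H.integrable_energy u).const_mul M) fun z => ?_)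
  have h1 := H.one_lt z
  have h3 : 1 ≤ M * (P z)⁻¹ := by
    rw [← div_eq_mul_inv, one_le_div (by linarith)]
    exact H.le_bound z
  calc |T u z| ^ P z ≤ (M * (P z)⁻¹) * |T u z| ^ P z := le_mul_of_one_le_left (hnn z) h3
    _ = _ := by ring

lemma upperModular_smul_le (H : ModularSystem μ T P M) {q c d : ℝ} (hc : 0 ≤ c)
    (hd : ∀ r, q ≤ r → r ≤ M → c ^ r ≤ d) (u : X) :
    upperModular μ T P q (c • u) ≤ d * upperModular μ T P q u := by
  rw [upperModular, upperModular, ← integral_const_mul]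
  refine integral_mono_ae (H.integrable _).integrableOn
    ((H.integrable u).integrableOn.const_mul d) ?_
  filter_upwards [ae_restrict_of_ae (H.smul c u),
    ae_restrict_mem (H.measurableSet_upper q)] with z h1 h2
  rw [h1, abs_mul, abs_of_nonneg hc, Real.mul_rpow hc (abs_nonneg _)]
  exact mul_le_mul_of_nonneg_right (hd _ h2 (H.le_bound z)) (by positivity)

/-- A modular with variable exponent is not homogeneous. Scaling `u` by `τ^(-1/r)` brings the upper
modular below `1` with `r = q` when `τ ≥ 1` and with `r = M` when `τ ≤ 1`; the sum of the two powers
covers both cases. -/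
lemma abs_apply_le (H : ModularSystem μ T P M) {q C τ : ℝ} (hq : 1 < q) (hqM : q ≤ M)
    {f : X →ₗ[ℝ] ℝ} (hf : ∀ u, upperModular μ T P q u ≤ 1 → |f u| ≤ C) (hτ : 0 < τ) {u : X}
    (hu : upperModular μ T P q u ≤ τ) : |f u| ≤ C * (τ ^ q⁻¹ + τ ^ M⁻¹) := by
  have hC : 0 ≤ C := by
    have : upperModular μ T P q (0 : X) ≤ 1 := by
      have := H.upperModular_smul_le (q := q) (c := 0) (d := 0) le_rfl
        (fun r hr _ => by rw [Real.zero_rpow (by linarith)]) (0 : X)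
      rw [zero_smul, zero_mul] at this
      linarith
    exact (abs_nonneg _).trans (hf 0 this)
  have main : ∀ r : ℝ, 0 < r → (∀ t, q ≤ t → t ≤ M → (τ ^ (-r⁻¹)) ^ t ≤ τ⁻¹) →
      |f u| ≤ C * τ ^ r⁻¹ := fun r hr h => by
    have h1 : upperModular μ T P q (τ ^ (-r⁻¹) • u) ≤ 1 := by
      refine (H.upperModular_smul_le (Real.rpow_nonneg hτ.le _) h u).trans ?_
      calc τ⁻¹ * upperModular μ T P q u ≤ τ⁻¹ * τ := by gcongr
        _ = 1 := inv_mul_cancel₀ hτ.ne'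
    have h2 := hf _ h1
    rw [map_smul, smul_eq_mul, abs_mul, abs_of_pos (Real.rpow_pos_of_pos hτ _)] at h2
    have h3 : |f u| = τ ^ r⁻¹ * (τ ^ (-r⁻¹) * |f u|) := by
      rw [← mul_assoc, ← Real.rpow_add hτ]; simp
    rw [h3, mul_comm C]
    gcongr
  have hM : 0 < M := by linarith
  have e1 := Real.rpow_nonneg hτ.le q⁻¹
  have e2 := Real.rpow_nonneg hτ.le M⁻¹
  rcases le_total 1 τ with h | h
  · have := main q (by linarith) fun t ht _ => by
      rw [← Real.rpow_mul hτ.le, ← Real.rpow_neg_one τ]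
      refine Real.rpow_le_rpow_of_exponent_le h ?_
      have : 1 ≤ q⁻¹ * t := by
        rw [inv_mul_eq_div, one_le_div (by linarith)]; exact ht
      linarith
    nlinarith
  · have := main M hM fun t _ ht => by
      rw [← Real.rpow_mul hτ.le, ← Real.rpow_neg_one τ]
      refine Real.rpow_le_rpow_of_exponent_ge hτ h ?_
      have : M⁻¹ * t ≤ 1 := by
        rw [inv_mul_eq_div, div_le_one hM]; exact ht
      linarith
    nlinarith

/-- The energy is at least `ρ / M`, with `ρ` the upper modular, whereas `|f u|` grows at most like
`ρ^(1/q)`. Since `q > 1`, half of the linear term absorbs it up to a constant. -/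
lemma exists_coercive (H : ModularSystem μ T P M) {q C : ℝ} (hq : 1 < q) (hqM : q ≤ M)
    {f : X →ₗ[ℝ] ℝ} (hf : ∀ u, upperModular μ T P q u ≤ 1 → |f u| ≤ C) :
    ∃ B : ℝ, ∀ u, upperModular μ T P q u / (2 * M) - B ≤ modularEnergy μ T P u - f u := by
  have hM : 0 < M := by linarith
  have hlim : Tendsto (fun τ : ℝ => τ ^ (1 - q⁻¹)) atTop atTop :=
    tendsto_rpow_atTop (sub_pos.2 (inv_lt_one_of_one_lt₀ hq))
  obtain ⟨τ₀, h1⟩ := (eventually_atTop.1 (hlim.eventually_ge_atTop (4 * |C| * M)))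
  -- Beyond `τ₁` the sublinear term satisfies `2|C| τ^(1/q) ≤ τ / (2M)`; below it, it is bounded by
  -- its value at `τ₁`.
  set τ₁ := max τ₀ 1 with hτ₁
  have h10 : 1 ≤ τ₁ := le_max_right _ _
  refine ⟨2 * |C| * τ₁ ^ q⁻¹ + 1 / (2 * M), fun u => ?_⟩
  set ρ := upperModular μ T P q u with hρ
  have hρ0 : 0 ≤ ρ := upperModular_nonneg q u
  set τ := max ρ 1 with hτ
  have hτ1 : 1 ≤ τ := le_max_right _ _
  have hτ0 : 0 < τ := by linarith
  have h2 := H.abs_apply_le hq hqM hf hτ0 (le_max_left ρ 1)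
  have h3 : τ ^ M⁻¹ ≤ τ ^ q⁻¹ := by
    refine Real.rpow_le_rpow_of_exponent_le hτ1 ?_
    exact inv_anti₀ (by linarith) hqM
  have h3' := Real.rpow_nonneg hτ0.le q⁻¹
  have h3'' := Real.rpow_nonneg hτ0.le M⁻¹
  have h4 : f u ≤ 2 * |C| * τ ^ q⁻¹ := by
    calc f u ≤ |f u| := le_abs_self _
      _ ≤ C * (τ ^ q⁻¹ + τ ^ M⁻¹) := h2
      _ ≤ |C| * (τ ^ q⁻¹ + τ ^ q⁻¹) := by
          gcongr
          exact le_abs_self C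
      _ = _ := by ring
  have h5 : 2 * |C| * τ ^ q⁻¹ ≤ 2 * |C| * τ₁ ^ q⁻¹ + τ / (2 * M) := by
    have hq0 : 0 ≤ q⁻¹ := by positivity
    rcases le_total τ τ₁ with h | h
    · have : 2 * |C| * τ ^ q⁻¹ ≤ 2 * |C| * τ₁ ^ q⁻¹ := by gcongr
      have : 0 ≤ τ / (2 * M) := by positivity
      linarith
    · have h6 := h1 τ ((le_max_left _ _).trans h)
      have h7 : τ = τ ^ (1 - q⁻¹) * τ ^ q⁻¹ := by
        rw [← Real.rpow_add hτ0]; simp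
      have h8 : 2 * |C| * τ ^ q⁻¹ ≤ τ / (2 * M) := by
        rw [le_div_iff₀ (by positivity)]
        calc 2 * |C| * τ ^ q⁻¹ * (2 * M) = (4 * |C| * M) * τ ^ q⁻¹ := by ring
          _ ≤ τ ^ (1 - q⁻¹) * τ ^ q⁻¹ := by gcongr
          _ = τ := h7.symm
      have : 0 ≤ 2 * |C| * τ₁ ^ q⁻¹ := by positivity
      linarith
  have h6 : ρ / M ≤ modularEnergy μ T P u := by
    rw [div_le_iff₀ hM, mul_comm]
    exact H.upperModular_le_energy q u
  have h7 : τ ≤ ρ + 1 := max_le (by linarith) (by linarith)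
  have h8 : τ / (2 * M) ≤ ρ / (2 * M) + 1 / (2 * M) := by
    rw [← add_div]; gcongr
  have h9 : ρ / M = ρ / (2 * M) + ρ / (2 * M) := by field_simp; ring
  linarith

/-- The scalar inequality is integrated over `{q ≤ P}`. The midpoint gap is nonnegative for every
exponent `P > 1`, so its integral over this set is at most the integral over all of `Z`, and `M / P
≥ 1` inserts the weight of the energy. -/
lemma exists_uniform_convexity (H : ModularSystem μ T P M) {q ε : ℝ} (hq : 1 < q) (hM : 0 ≤ M)
    (hε : 0 < ε) :
    ∃ C : ℝ, 0 ≤ C ∧ ∀ u v : X, upperModular μ T P q (u - v) ≤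
      ε * (upperModular μ T P q u + upperModular μ T P q v) +
      C * ((modularEnergy μ T P u + modularEnergy μ T P v) / 2 -
        modularEnergy μ T P ((1 / 2 : ℝ) • (u + v))) := by
  obtain ⟨C, hC, h⟩ := FracVarExp.exists_uniform_convexity (M := M) hq hε
  refine ⟨C * M, by positivity, fun u v => ?_⟩
  set w := (1 / 2 : ℝ) • (u + v) with hw
  have hwae : ∀ᵐ z ∂μ, T w z = (T u z + T v z) / 2 := by
    filter_upwards [H.smul (1 / 2) (u + v), H.add u v] with z h1 h2
    rw [hw, h1, h2]; ring
  have iu := H.integrable u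
  have iv := H.integrable v
  have iw := H.integrable w
  set g : Z → ℝ := fun z => (|T u z| ^ P z + |T v z| ^ P z) / 2 - |T w z| ^ P z with hg
  have hgi : Integrable g μ := ((iu.add iv).div_const 2).sub iw
  have hgnn : 0 ≤ᵐ[μ] g := by
    filter_upwards [hwae] with z h1
    simp only [hg, h1, Pi.zero_apply]
    exact sub_nonneg.2 (abs_midpoint_rpow_le (H.one_lt z))
  have hge : ∫ z, (P z)⁻¹ * g z ∂μ =
      (modularEnergy μ T P u + modularEnergy μ T P v) / 2 - modularEnergy μ T P w := by
    rw [modularEnergy, modularEnergy, modularEnergy,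
      ← integral_add (H.integrable_energy u) (H.integrable_energy v), ← integral_div,
      ← integral_sub]
    · refine integral_congr_ae (Eventually.of_forall fun z => ?_)
      simp only [hg]; ring
    · exact ((H.integrable_energy u).add (H.integrable_energy v)).div_const 2
    · exact H.integrable_energy w
  have hgei : Integrable (fun z => (P z)⁻¹ * g z) μ := by
    have := (((H.integrable_energy u).add (H.integrable_energy v)).div_const 2).sub
      (H.integrable_energy w)
    refine this.congr (Eventually.of_forall fun z => ?_)
    simp only [hg, Pi.add_apply, Pi.sub_apply]; ring
  have h1 : ∫ z in {z | q ≤ P z}, g z ∂μ ≤ M * ∫ z, (P z)⁻¹ * g z ∂μ := by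
    rw [← integral_const_mul]
    refine (setIntegral_le_integral hgi hgnn).trans
      (integral_mono_ae hgi (hgei.const_mul M) ?_)
    filter_upwards [hgnn] with z hz
    have h1 := H.one_lt z
    have h3 : 1 ≤ M * (P z)⁻¹ := by
      rw [← div_eq_mul_inv, one_le_div (by linarith)]
      exact H.le_bound z
    calc g z ≤ (M * (P z)⁻¹) * g z := le_mul_of_one_le_left hz h3
      _ = _ := by ring
  have h2 : upperModular μ T P q (u - v) ≤
      ε * (upperModular μ T P q u + upperModular μ T P q v) +
        C * ∫ z in {z | q ≤ P z}, g z ∂μ := by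
    simp only [upperModular]
    rw [← integral_add iu.integrableOn iv.integrableOn, ← integral_const_mul,
      ← integral_const_mul, ← integral_add]
    · refine integral_mono_ae (H.integrable _).integrableOn ?_ ?_
      · exact ((iu.add iv).integrableOn.const_mul ε).add (hgi.integrableOn.const_mul C)
      · filter_upwards [ae_restrict_of_ae hwae, ae_restrict_of_ae (H.sub u v),
          ae_restrict_mem (H.measurableSet_upper q)] with z h1 h2 h3
        simp only [hg, h1, h2]
        exact h _ _ _ h3 (H.le_bound z)
    · exact (iu.add iv).integrableOn.const_mul ε
    · exact hgi.integrableOn.const_mul C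
  rw [← hge]
  calc _ ≤ _ := h2
    _ ≤ ε * (upperModular μ T P q u + upperModular μ T P q v) +
        C * (M * ∫ z, (P z)⁻¹ * g z ∂μ) := by gcongr
    _ = _ := by ring

/-- Completeness of a modular system: a bounded sequence that is Cauchy for the modular has a
subsequence converging almost everywhere to an element of the system. -/
def IsComplete (μ : Measure Z) (T : X → Z → ℝ) (P : Z → ℝ) (q : ℝ) : Prop :=
  ∀ (u : ℕ → X) (B : ℝ), (∀ n, upperModular μ T P q (u n) ≤ B) →
    (∀ ε > 0, ∃ n₀, ∀ m ≥ n₀, ∀ n ≥ n₀, upperModular μ T P q (u m - u n) ≤ ε) →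
    ∃ (v : X) (φ : ℕ → ℕ), StrictMono φ ∧
      ∀ᵐ z ∂μ, Tendsto (fun k => T (u (φ k)) z) atTop (𝓝 (T v z))

lemma tendsto_rpow (H : ModularSystem μ T P M) {g : ℕ → ℝ} {a : ℝ} (z : Z)
    (h : Tendsto g atTop (𝓝 a)) :
    Tendsto (fun k => |g k| ^ P z) atTop (𝓝 (|a| ^ P z)) :=
  h.abs.rpow_const (Or.inr (by linarith [H.one_lt z]))

lemma exists_minimizer (H : ModularSystem μ T P M) {q C : ℝ} (hq : 1 < q) (hqM : q ≤ M)
    {f : X →ₗ[ℝ] ℝ} (hf : ∀ u, upperModular μ T P q u ≤ 1 → |f u| ≤ C)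
    (hcomp : IsComplete μ T P q) :
    ∃ u, ∀ v, modularEnergy μ T P u - f u ≤ modularEnergy μ T P v - f v := by
  have hM : 0 < M := by linarith
  obtain ⟨B, hB⟩ := H.exists_coercive hq hqM hf
  set J : X → ℝ := fun u => modularEnergy μ T P u - f u with hJ
  have hbdd : BddBelow (range J) := by
    refine ⟨-B, ?_⟩
    rintro _ ⟨u, rfl⟩
    have h1 := hB u
    have h2 : 0 ≤ upperModular μ T P q u / (2 * M) :=
      div_nonneg (upperModular_nonneg q u) (by positivity)
    simp only [hJ]
    linarith
  set I := sInf (range J) with hI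
  have hIle : ∀ v, I ≤ J v := fun v => csInf_le hbdd ⟨v, rfl⟩
  have hex : ∀ n : ℕ, ∃ u, J u < I + 1 / ((n : ℝ) + 1) := fun n => by
    obtain ⟨_, ⟨u, rfl⟩, hu⟩ := exists_lt_of_csInf_lt (range_nonempty J)
      (lt_add_of_pos_right I (by positivity : (0 : ℝ) < 1 / ((n : ℝ) + 1)))
    exact ⟨u, hu⟩
  choose u hu using hex
  have hsmall : ∀ δ > 0, ∃ n₀ : ℕ, ∀ n ≥ n₀, J (u n) ≤ I + δ := fun δ hδ => by
    obtain ⟨n₀, hn₀⟩ := exists_nat_one_div_lt hδ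
    refine ⟨n₀, fun n hn => (hu n).le.trans ?_⟩
    have : 1 / ((n : ℝ) + 1) ≤ 1 / ((n₀ : ℝ) + 1) := by gcongr
    linarith
  set R := 2 * M * (I + 1 + B) with hR
  have hRu : ∀ n, upperModular μ T P q (u n) ≤ R := fun n => by
    have h1 := hB (u n)
    have h2 := (hu n).le
    have h3 : 1 / ((n : ℝ) + 1) ≤ 1 := by
      rw [div_le_one (by positivity)]
      have : (0 : ℝ) ≤ n := by positivity
      linarith
    have h4 : upperModular μ T P q (u n) / (2 * M) ≤ I + 1 + B := by
      simp only [hJ] at h2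
      linarith
    rw [div_le_iff₀ (by positivity)] at h4
    linarith
  have hR0 : 0 ≤ R := (upperModular_nonneg q (u 0)).trans (hRu 0)
  have hcauchy : ∀ ε > 0, ∃ n₀, ∀ m ≥ n₀, ∀ n ≥ n₀,
      upperModular μ T P q (u m - u n) ≤ ε := fun ε hε => by
    -- This `ε` and the tolerance on `J` below are chosen so that each of the two terms of the
    -- convexity estimate is at most `ε / 2`.
    obtain ⟨C', hC', hconv⟩ := H.exists_uniform_convexity (ε := ε / (4 * (R + 1))) hq hM.le
      (by positivity)
    obtain ⟨n₀, hn₀⟩ := hsmall (ε / (2 * (C' + 1))) (by positivity)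
    refine ⟨n₀, fun m hm n hn => ?_⟩
    have h1 := hn₀ m hm
    have h2 := hn₀ n hn
    -- The midpoint cannot go below the infimum `I`. As `f` is linear it cancels, and only the
    -- convexity gap of the energy remains.
    have h3 := hIle ((1 / 2 : ℝ) • (u m + u n))
    simp only [hJ, map_smul, map_add, smul_eq_mul] at h1 h2 h3
    have h4 : (modularEnergy μ T P (u m) + modularEnergy μ T P (u n)) / 2 -
        modularEnergy μ T P ((1 / 2 : ℝ) • (u m + u n)) ≤ ε / (2 * (C' + 1)) := by
      linarith
    calc _ ≤ _ := hconv (u m) (u n)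
      _ ≤ ε / (4 * (R + 1)) * (R + R) + C' * (ε / (2 * (C' + 1))) := by
          gcongr
          · exact hRu m
          · exact hRu n
      _ = ε / 2 * (R / (R + 1)) + ε / 2 * (C' / (C' + 1)) := by
          field_simp
          ring
      _ ≤ ε / 2 * 1 + ε / 2 * 1 := by
          gcongr
          · rw [div_le_one (by positivity)]; linarith
          · rw [div_le_one (by positivity)]; linarith
      _ = ε := by ring
  obtain ⟨v, φ, hφ, hlim⟩ := hcomp u R hRu hcauchy
  refine ⟨v, fun w => le_trans ?_ (hIle w)⟩
  -- Along the subsequence `f (u_k) → f v`: Fatou's lemma in the second index of the Cauchy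
  -- condition makes the upper modular of `u_k - v` small, and `abs_apply_le` passes this to `f`.
  have hf0 : ∀ δ > 0, ∀ᶠ k in atTop, |f (u (φ k)) - f v| ≤ δ := fun δ hδ => by
    have ht : Tendsto (fun τ : ℝ => C * (τ ^ q⁻¹ + τ ^ M⁻¹)) (𝓝 0) (𝓝 0) := by
      have h1 : Tendsto (fun τ : ℝ => τ ^ q⁻¹) (𝓝 0) (𝓝 (0 ^ q⁻¹)) :=
        tendsto_id.rpow_const (Or.inr (by positivity))
      have h2 : Tendsto (fun τ : ℝ => τ ^ M⁻¹) (𝓝 0) (𝓝 (0 ^ M⁻¹)) :=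
        tendsto_id.rpow_const (Or.inr (by positivity))
      have h3 := (h1.add h2).const_mul C
      rwa [Real.zero_rpow (by positivity), Real.zero_rpow (by positivity), add_zero,
        mul_zero] at h3
    have ht' : ∀ᶠ τ in 𝓝[>] (0 : ℝ), C * (τ ^ q⁻¹ + τ ^ M⁻¹) < δ :=
      (ht.mono_left nhdsWithin_le_nhds).eventually (gt_mem_nhds hδ)
    obtain ⟨τ, hτ, hτ0⟩ := (ht'.and self_mem_nhdsWithin).exists
    obtain ⟨n₀, hn₀⟩ := hcauchy τ hτ0
    filter_upwards [hφ.tendsto_atTop.eventually_ge_atTop n₀] with k hk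
    have h1 : upperModular μ T P q (u (φ k) - v) ≤ τ := by
      refine integral_le_of_ae_tendsto (μ := μ.restrict {z | q ≤ P z})
        (g := fun j z => |T (u (φ k) - u (φ j)) z| ^ P z)
        (fun j z => by positivity) (fun j => (H.integrable _).integrableOn)
        (fun j => H.measurable_rpow (H.measurable _)) (fun z => by positivity)
        (H.measurable_rpow (H.measurable _)) (ae_restrict_of_ae ?_) ?_
      · filter_upwards [hlim, H.sub (u (φ k)) v,
          ae_all_iff.2 fun j => H.sub (u (φ k)) (u (φ j))] with z h1 h2 h3
        simp only [h2, h3]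
        exact H.tendsto_rpow z (h1.const_sub _)
      · filter_upwards [hφ.tendsto_atTop.eventually_ge_atTop n₀] with j hj
        exact hn₀ _ hk _ hj
    rw [← map_sub]
    exact (H.abs_apply_le hq hqM hf hτ0 h1).trans hτ.le
  refine le_of_forall_pos_le_add fun δ hδ => ?_
  have h1 : modularEnergy μ T P v ≤ I + f v + δ := by
    refine integral_le_of_ae_tendsto (g := fun k z => (P z)⁻¹ * |T (u (φ k)) z| ^ P z)
      (fun j z => ?_) (fun k => H.integrable_energy _)
      (fun k => H.measurable_exponent.inv.mul (H.measurable_rpow (H.measurable _)))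
      (fun z => ?_) (H.measurable_exponent.inv.mul (H.measurable_rpow (H.measurable _))) ?_ ?_
    · have := H.one_lt z
      positivity
    · have := H.one_lt z
      positivity
    · filter_upwards [hlim] with z hz
      exact (H.tendsto_rpow z hz).const_mul _
    · obtain ⟨n₀, hn₀⟩ := hsmall (δ / 2) (by positivity)
      filter_upwards [hφ.tendsto_atTop.eventually_ge_atTop n₀, hf0 (δ / 2) (by positivity)]
        with k h1 h2
      have h3 := hn₀ _ h1
      have h4 := (abs_le.1 h2).2
      simp only [hJ] at h3
      change modularEnergy μ T P (u (φ k)) ≤ _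
      linarith
  linarith

lemma integrable_weak (H : ModularSystem μ T P M) (u φ : X) :
    Integrable (fun z => |T u z| ^ (P z - 2) * T u z * T φ z) μ := by
  have hm : Measurable fun z => |T u z| ^ (P z - 2) * T u z * T φ z :=
    (((measurable_norm.comp (H.measurable u)).pow
      (H.measurable_exponent.sub_const 2)).mul (H.measurable u)).mul (H.measurable φ)
  refine ((H.integrable u).add (H.integrable φ)).mono' hm.aestronglyMeasurable
    (Eventually.of_forall fun z => ?_)
  have h1 : 0 ≤ |T u z| ^ P z := by positivity
  have h2 : 0 ≤ |T φ z| ^ P z := by positivity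
  rw [Real.norm_eq_abs, Pi.add_apply]
  refine (abs_rpow_sub_two_mul_mul_le (H.one_lt z) (le_max_left _ _) (le_max_right _ _)).trans ?_
  rcases max_choice |T u z| |T φ z| with h | h <;> rw [h] <;> linarith

/-- The function `t ↦ J (u + t φ)` has a minimum at `0`. For `|t| < 1` the derivative of its
integrand is dominated by `2^M (|T u|^P + |T φ|^P)`, so it may be taken under the integral. -/
lemma integral_weak_of_minimizer (H : ModularSystem μ T P M) {f : X →ₗ[ℝ] ℝ} {u : X}
    (hu : ∀ v, modularEnergy μ T P u - f u ≤ modularEnergy μ T P v - f v) (φ : X) :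
    ∫ z, |T u z| ^ (P z - 2) * T u z * T φ z ∂μ = f φ := by
  set F : ℝ → Z → ℝ := fun t z => (P z)⁻¹ * |T u z + t * T φ z| ^ P z with hF
  set F' : ℝ → Z → ℝ :=
    fun t z => |T u z + t * T φ z| ^ (P z - 2) * (T u z + t * T φ z) * T φ z with hF'
  have hmeas : ∀ t, Measurable fun z => T u z + t * T φ z := fun t =>
    (H.measurable u).add ((H.measurable φ).const_mul t)
  have hFm : ∀ t, Measurable (F t) := fun t =>
    H.measurable_exponent.inv.mul (H.measurable_rpow (hmeas t))
  have hF'm : Measurable (F' 0) :=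
    (((measurable_norm.comp (hmeas 0)).pow
      (H.measurable_exponent.sub_const 2)).mul (hmeas 0)).mul (H.measurable φ)
  have hFe : ∀ t, ∫ z, F t z ∂μ = modularEnergy μ T P (u + t • φ) := fun t => by
    refine integral_congr_ae ?_
    filter_upwards [H.add u (t • φ), H.smul t φ] with z h1 h2
    simp only [hF, h1, h2]
  have hF0 : F 0 = fun z => (P z)⁻¹ * |T u z| ^ P z := by
    funext z; simp [hF]
  have hbound : Integrable (fun z => 2 ^ M * (|T u z| ^ P z + |T φ z| ^ P z)) μ :=
    ((H.integrable u).add (H.integrable φ)).const_mul _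
  have hder := hasDerivAt_integral_of_dominated_loc_of_deriv_le (μ := μ) (F := F) (F' := F')
    (x₀ := 0) (Metric.ball_mem_nhds (0 : ℝ) one_pos)
    (Eventually.of_forall fun t => (hFm t).aestronglyMeasurable)
    (by rw [hF0]; exact H.integrable_energy u) hF'm.aestronglyMeasurable
    (Eventually.of_forall fun z t ht => by
      have h1 := H.one_lt z
      have ht1 : |t| ≤ 1 := by
        rw [mem_ball_zero_iff] at ht
        exact ht.le
      have h2 : |T u z + t * T φ z| ≤ |T u z| + |T φ z| := by
        refine (abs_add_le _ _).trans ?_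
        rw [abs_mul]
        have := mul_le_of_le_one_left (abs_nonneg (T φ z)) ht1
        linarith
      refine (abs_rpow_sub_two_mul_mul_le h1 h2
        (le_add_of_nonneg_left (abs_nonneg _))).trans ?_
      refine (rpow_add_le (abs_nonneg _) (abs_nonneg _) (by linarith)).trans ?_
      have h3 : (2 : ℝ) ^ P z ≤ 2 ^ M :=
        Real.rpow_le_rpow_of_exponent_le one_le_two (H.le_bound z)
      gcongr)
    hbound
    (Eventually.of_forall fun z t _ => by
      have h1 := H.one_lt z
      have h2 : HasDerivAt (fun t => T u z + t * T φ z) (T φ z) t := by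
        simpa using ((hasDerivAt_id t).mul_const (T φ z)).const_add (T u z)
      have h3 := ((hasDerivAt_abs_rpow (T u z + t * T φ z) h1).comp t h2).const_mul (P z)⁻¹
      refine h3.congr_deriv ?_
      have : P z ≠ 0 := by linarith
      change _ = |T u z + t * T φ z| ^ (P z - 2) * (T u z + t * T φ z) * T φ z
      field_simp)
  have hd := hder.2
  have hmin : IsLocalMin (fun t => ∫ z, F t z ∂μ - t * f φ) 0 := by
    refine Eventually.of_forall fun t => ?_
    have := hu (u + t • φ)
    simp only [hFe, map_add, map_smul, smul_eq_mul] at this ⊢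
    simp only [zero_smul, add_zero, zero_mul, sub_zero]
    linarith
  have h0 := hmin.hasDerivAt_eq_zero (hd.sub ((hasDerivAt_id (0 : ℝ)).mul_const (f φ)))
  have h1 : F' 0 = fun z => |T u z| ^ (P z - 2) * T u z * T φ z := by
    funext z; simp [hF']
  rw [h1] at h0
  linarith

/-- Subtracting the two sides gives a nonnegative integrand with zero integral, and by
`monotone_gap_pos` it is positive wherever `T u ≠ T v`. -/
lemma ae_eq_of_integral_weak_eq (H : ModularSystem μ T P M) {u v : X}
    (h : ∫ z, |T u z| ^ (P z - 2) * T u z * T (u - v) z ∂μ =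
      ∫ z, |T v z| ^ (P z - 2) * T v z * T (u - v) z ∂μ) :
    ∀ᵐ z ∂μ, T (u - v) z = 0 := by
  have i1 := H.integrable_weak u (u - v)
  have i2 := H.integrable_weak v (u - v)
  have h0 : ∫ z, (|T u z| ^ (P z - 2) * T u z * T (u - v) z -
      |T v z| ^ (P z - 2) * T v z * T (u - v) z) ∂μ = 0 := by
    rw [integral_sub i1 i2, h, sub_self]
  have hnn : 0 ≤ᵐ[μ] fun z => (|T u z| ^ (P z - 2) * T u z * T (u - v) z -
      |T v z| ^ (P z - 2) * T v z * T (u - v) z) := by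
    filter_upwards [H.sub u v] with z hz
    rw [hz, ← sub_mul, Pi.zero_apply]
    by_cases h : T u z = T v z
    · rw [h]; simp
    · exact (monotone_gap_pos (H.one_lt z) h).le
  rw [integral_eq_zero_iff_of_nonneg_ae hnn (i1.sub i2)] at h0
  filter_upwards [h0, H.sub u v] with z h1 h2
  by_contra hne
  have hne' : T u z ≠ T v z := fun h => hne (by rw [h2, h, sub_self])
  rw [h2, ← sub_mul] at h1
  exact (monotone_gap_pos (H.one_lt z) hne').ne' h1

/-- Existence and uniqueness for the variational equation of a complete modular system. -/
theorem existsUnique (H : ModularSystem μ T P M) {q C : ℝ} (hq : 1 < q) (hqM : q ≤ M)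
    {f : X →ₗ[ℝ] ℝ} (hf : ∀ u, upperModular μ T P q u ≤ 1 → |f u| ≤ C)
    (hcomp : IsComplete μ T P q) (hinj : ∀ u, (∀ᵐ z ∂μ, T u z = 0) → u = 0) :
    ∃! u, ∀ φ, Integrable (fun z => |T u z| ^ (P z - 2) * T u z * T φ z) μ ∧
      ∫ z, |T u z| ^ (P z - 2) * T u z * T φ z ∂μ = f φ := by
  obtain ⟨u, hu⟩ := H.exists_minimizer hq hqM hf hcomp
  refine ⟨u, fun φ => ⟨H.integrable_weak u φ, H.integral_weak_of_minimizer hu φ⟩,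
    fun v hv => sub_eq_zero.1 (hinj _ (H.ae_eq_of_integral_weak_eq ?_))⟩
  rw [(hv _).2, H.integral_weak_of_minimizer hu]

end ModularSystem

/-! ### Control of `u` on `Ω` by the upper Gagliardo modular -/

/-- The integrand `|u(x) - u(y)| ^ p(x,y) K(x,y)` of the Gagliardo modular. -/
def pairDensity {N : ℕ} (s : ℝ) (p : Eucl N → Eucl N → ℝ) (u : Eucl N → ℝ)
    (z : Eucl N × Eucl N) : ENNReal :=
  ENNReal.ofReal (|u z.1 - u z.2| ^ p z.1 z.2) * ENNReal.ofReal (singularKernel s p z.1 z.2)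

/-- The Gagliardo modular over the pairs where the exponent is at least `q`. -/
def upperGag {N : ℕ} (q s : ℝ) (p : Eucl N → Eucl N → ℝ) (u : Eucl N → ℝ) : ENNReal :=
  ∫⁻ z in {z : Eucl N × Eucl N | q ≤ p z.1 z.2}, pairDensity s p u z

section

variable {N : ℕ} {Ω : Set (Eucl N)} {p : Eucl N → Eucl N → ℝ} {s q M R : ℝ}

lemma measurable_pairDensity (hp : IsVariableExponent p) (s : ℝ) {u : Eucl N → ℝ}
    (hu : Measurable u) : Measurable (pairDensity s p u) := by
  have h3 : Measurable fun z : Eucl N × Eucl N => u z.1 - u z.2 :=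
    (hu.comp measurable_fst).sub (hu.comp measurable_snd)
  exact ((measurable_norm.comp h3).pow hp.continuous.measurable).ennreal_ofReal.mul
    (singularKernel_measurable hp s).ennreal_ofReal

lemma measurableSet_upperPairs (hp : IsVariableExponent p) (q : ℝ) :
    MeasurableSet {z : Eucl N × Eucl N | q ≤ p z.1 z.2} :=
  measurableSet_le measurable_const hp.continuous.measurable

lemma one_le_mul_singularKernel (hp : IsVariableExponent p) (hM : ∀ x y, p x y ≤ M)
    (hs : 0 < s) {D : ℝ} (hD : 1 ≤ D) {x y : Eucl N} (hxy : x ≠ y) (h : ‖x - y‖ ≤ D) :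
    1 ≤ D ^ ((N : ℝ) + s * M) * singularKernel s p x y := by
  have h0 : 0 < ‖x - y‖ := norm_pos_iff.2 (sub_ne_zero.2 hxy)
  have h1 := hp.one_lt x y
  have h2 : 0 < (N : ℝ) + s * p x y := by positivity
  have h3 : D ^ (-((N : ℝ) + s * M)) ≤ singularKernel s p x y :=
    calc D ^ (-((N : ℝ) + s * M)) ≤ D ^ (-((N : ℝ) + s * p x y)) := by
          refine Real.rpow_le_rpow_of_exponent_le hD ?_
          have := mul_le_mul_of_nonneg_left (hM x y) hs.le
          linarith
      _ ≤ _ := Real.rpow_le_rpow_of_nonpos h0 h (by linarith)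
  calc 1 = D ^ ((N : ℝ) + s * M) * D ^ (-((N : ℝ) + s * M)) := by
        rw [← Real.rpow_add (by linarith)]; simp
    _ ≤ _ := by gcongr

/-- The values of `u` on `Ω` are controlled by differences with an exterior ball, where `u`
vanishes. -/
lemma exists_lintegral_abs_le (hN : N ≠ 0) (hΩm : MeasurableSet Ω) (hR : 0 < R)
    (hΩ : Ω ⊆ Metric.ball 0 R) (hp : IsVariableExponent p) (hM : ∀ x y, p x y ≤ M) (hs : 0 < s)
    (hq : ∀ x ∈ Metric.closedBall 0 (R + 2), ∀ y ∈ Metric.closedBall 0 (R + 2), q ≤ p x y) :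
    ∃ C : ENNReal, C ≠ ⊤ ∧ ∀ u : Eucl N → ℝ, Measurable u → (∀ᵐ x, x ∉ Ω → u x = 0) →
      ∀ ε : ℝ, 0 < ε → ε ≤ 1 → ∫⁻ x in Ω, ENNReal.ofReal |u x| ≤
        ENNReal.ofReal ε * volume Ω + C * ENNReal.ofReal (ε ^ (1 - M)) * upperGag q s p u := by
  have : NeZero N := ⟨hN⟩
  -- The unit ball about a point of norm `R + 1` lies in the shell `R < |y| < R + 2`: it misses `Ω`,
  -- yet its pairs with `Ω` have exponent at least `q`. This is why the hypothesis on `q` involves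
  -- radius `R + 2`.
  obtain ⟨c, hc⟩ := exists_norm_eq (Eucl N) (by linarith : 0 ≤ R + 1)
  set B : Set (Eucl N) := Metric.ball c 1 with hB
  have hBn : ∀ y ∈ B, R < ‖y‖ ∧ ‖y‖ < R + 2 := fun y hy => by
    rw [hB, mem_ball_iff_norm] at hy
    have h1 := norm_sub_norm_le c y
    have h2 := norm_sub_norm_le y c
    rw [norm_sub_rev] at h1
    constructor <;> linarith
  have hΩn : ∀ x ∈ Ω, ‖x‖ < R := fun x hx => mem_ball_zero_iff.1 (hΩ hx)
  have hv0 : volume B ≠ 0 := (Metric.measure_ball_pos _ _ one_pos).ne'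
  have hvt : volume B ≠ ⊤ := measure_ball_lt_top.ne
  set D : ℝ := 2 * R + 2 with hD
  set E : ℝ := D ^ ((N : ℝ) + s * M) with hE
  have hE0 : 0 ≤ E := Real.rpow_nonneg (by linarith) _
  have hBm : MeasurableSet B := measurableSet_ball
  refine ⟨ENNReal.ofReal E / volume B, ENNReal.div_ne_top ENNReal.ofReal_ne_top hv0,
    fun u hu hu0 ε hε hε1 => ?_⟩
  have hpt : ∀ᵐ z ∂(volume : Measure (Eucl N × Eucl N)).restrict (Ω ×ˢ B),
      ENNReal.ofReal |u z.1| ≤ ENNReal.ofReal ε +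
        ENNReal.ofReal (ε ^ (1 - M)) * ENNReal.ofReal E * pairDensity s p u z := by
    filter_upwards [ae_pair hu0 _, ae_restrict_mem (hΩm.prod hBm)] with z h1 h2
    have hy : z.2 ∉ Ω := fun h => by
      have := hΩn _ h
      have := (hBn _ h2.2).1
      linarith
    have hxy : z.1 ≠ z.2 := fun h => hy (h ▸ h2.1)
    have h3 : ‖z.1 - z.2‖ ≤ D := by
      refine (norm_sub_le _ _).trans ?_
      have := hΩn _ h2.1
      have := (hBn _ h2.2).2
      linarith
    have h4 := one_le_mul_singularKernel hp hM hs (by linarith : 1 ≤ D) hxy h3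
    have h5 := le_add_rpow_mul (abs_nonneg (u z.1)) hε hε1 (hp.one_lt z.1 z.2).le (hM z.1 z.2)
    rw [pairDensity, h1.2 hy, sub_zero, ← ENNReal.ofReal_mul (by positivity),
      ← ENNReal.ofReal_mul (by positivity), ← ENNReal.ofReal_mul (by positivity),
      ← ENNReal.ofReal_add hε.le]
    · refine ENNReal.ofReal_le_ofReal (h5.trans ?_)
      have h6 : 0 ≤ ε ^ (1 - M) * |u z.1| ^ p z.1 z.2 := by positivity
      have := mul_le_mul_of_nonneg_left h4 h6
      rw [← hE] at this
      linarith
    · have : 0 ≤ singularKernel s p z.1 z.2 := Real.rpow_nonneg (norm_nonneg _) _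
      positivity
  have hsub : Ω ×ˢ B ⊆ {z : Eucl N × Eucl N | q ≤ p z.1 z.2} := fun z hz => by
    refine hq _ ?_ _ ?_
    · rw [mem_closedBall_zero_iff]
      linarith [hΩn _ hz.1]
    · rw [mem_closedBall_zero_iff]
      linarith [(hBn _ hz.2).2]
  have h1 := lintegral_mono_ae hpt
  rw [lintegral_add_left measurable_const, lintegral_const,
    lintegral_const_mul _ (measurable_pairDensity hp s hu), Measure.restrict_apply_univ,
    Measure.volume_eq_prod, Measure.prod_prod, ← Measure.prod_restrict,
    lintegral_prod _ (by fun_prop)] at h1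
  simp only [lintegral_const, Measure.restrict_apply_univ] at h1
  rw [lintegral_mul_const _ (by fun_prop), Measure.prod_restrict,
    ← Measure.volume_eq_prod] at h1
  have h2 : ∫⁻ z in Ω ×ˢ B, pairDensity s p u z ≤ upperGag q s p u := lintegral_mono_set hsub
  -- The left side does not depend on `y`, so integrating over `Ω ×ˢ B` produced a factor `volume
  -- B`, which is now divided out.
  rw [← ENNReal.le_div_iff_mul_le (Or.inl hv0) (Or.inl hvt)] at h1
  refine h1.trans ?_
  rw [ENNReal.div_eq_inv_mul, mul_add, ENNReal.div_eq_inv_mul]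
  refine add_le_add (le_of_eq ?_) ?_
  · rw [mul_comm, mul_assoc, mul_assoc, ENNReal.mul_inv_cancel hv0 hvt, mul_one]
  · calc _ ≤ (volume B)⁻¹ * (ENNReal.ofReal (ε ^ (1 - M)) * ENNReal.ofReal E *
        upperGag q s p u) := by gcongr
      _ = _ := by ring

/-- Near a point where `|u|` is large, `u` is at most half as large on a definite portion of a
small ball; the singular kernel then yields a gain of integrability. -/
lemma exists_rpow_diag_le (hN : N ≠ 0) (hp : IsVariableExponent p) (hM : ∀ x y, p x y ≤ M)
    (hs : 0 < s) {L r₀ : ℝ} (hL : 0 < L) (hr0 : 0 < r₀) (hr1 : r₀ ≤ 1) :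
    ∃ T C : ℝ, 1 ≤ T ∧ 0 ≤ C ∧ ∀ u : Eucl N → ℝ, Measurable u →
      ∫⁻ x, ENNReal.ofReal |u x| ≤ ENNReal.ofReal L → ∀ x,
      (∀ y ∈ Metric.ball x r₀, p x x - s / N ≤ p x y) → T ≤ |u x| →
      ENNReal.ofReal (|u x| ^ p x x) ≤
        ENNReal.ofReal C * ∫⁻ y in Metric.ball x r₀, pairDensity s p u (x, y) := by
  have : NeZero N := ⟨hN⟩
  have hN0 : (0 : ℝ) < N := by exact_mod_cast Nat.pos_of_ne_zero hN
  set v : ℝ := (volume (Metric.ball (0 : Eucl N) 1)).toReal with hv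
  have hv0 : 0 < v := ENNReal.toReal_pos (Metric.measure_ball_pos _ _ one_pos).ne'
    measure_ball_lt_top.ne
  set a : ℝ := 8 * L / v with ha
  have ha0 : 0 < a := by positivity
  set η : ℝ := s / N with hη
  have hη0 : 0 < η := by positivity
  -- `T ≥ 2` makes `t / 2 ≥ 1`, so lowering the exponent lowers the power; `T ≥ a / r₀ ^ N` makes
  -- the radius `r` chosen below at most `r₀`.
  refine ⟨max 2 (a / r₀ ^ N), 2 ^ M * a ^ (1 + η) / (4 * L),
    (by norm_num : (1 : ℝ) ≤ 2).trans (le_max_left _ _), by positivity,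
    fun u hu huL x hpx hT => ?_⟩
  set t := |u x| with ht
  have ht2 : 2 ≤ t := (le_max_left _ _).trans hT
  have ht0 : 0 < t := by linarith
  set r : ℝ := (a / t) ^ ((N : ℝ)⁻¹) with hr
  have hrpos : 0 < r := Real.rpow_pos_of_pos (by positivity) _
  have hrN : r ^ N = a / t := Real.rpow_inv_natCast_pow (by positivity) hN
  have hrr0 : r ≤ r₀ := by
    have h1 : r ^ N ≤ r₀ ^ N := by
      rw [hrN, div_le_iff₀ ht0, mul_comm, ← div_le_iff₀ (by positivity)]
      exact (le_max_right _ _).trans hT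
    exact le_of_pow_le_pow_left₀ hN hr0.le h1
  -- The ball of radius `r` has volume `8L / t`, while by Markov's inequality `|u| ≥ t / 2` on a set
  -- of volume at most `2L / t`. Thus `A`, where `|u| < t / 2`, has volume at least `4L / t`.
  set A : Set (Eucl N) := Metric.ball x r \ {y | ENNReal.ofReal (t / 2) ≤ ENNReal.ofReal |u y|}
    with hA
  have hAm : MeasurableSet A := measurableSet_ball.diff
    (measurableSet_le measurable_const (measurable_norm.comp hu).ennreal_ofReal)
  have hvolball : volume (Metric.ball x r) = ENNReal.ofReal (8 * L / t) := by
    rw [Measure.addHaar_ball volume x hrpos.le, finrank_euclideanSpace_fin, hrN,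
      ← ENNReal.ofReal_toReal (measure_ball_lt_top (μ := volume) (x := (0 : Eucl N))).ne, ← hv,
      ← ENNReal.ofReal_mul (by positivity)]
    congr 1
    rw [ha]; field_simp
  have hvolA : ENNReal.ofReal (4 * L / t) ≤ volume A := by
    refine le_trans ?_ le_measure_sdiff
    have h1 : volume {y | ENNReal.ofReal (t / 2) ≤ ENNReal.ofReal |u y|} ≤
        ENNReal.ofReal (2 * L / t) := by
      refine (meas_ge_le_lintegral_div (measurable_norm.comp hu).ennreal_ofReal.aemeasurable
        (by simpa using ht0) ENNReal.ofReal_ne_top).trans ?_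
      refine (ENNReal.div_le_div_right huL _).trans (le_of_eq ?_)
      rw [← ENNReal.ofReal_div_of_pos (by positivity)]
      congr 1
      field_simp
    rw [hvolball]
    refine le_trans ?_ (tsub_le_tsub_left h1 _)
    rw [← ENNReal.ofReal_sub _ (by positivity)]
    refine ENNReal.ofReal_le_ofReal ?_
    rw [← sub_div]
    gcongr
    linarith
  set κ : ℝ := (t / 2) ^ (p x x - η) * r ^ (-((N : ℝ) + s)) with hκ
  have hlow : ∀ y ∈ A, ENNReal.ofReal κ ≤ pairDensity s p u (x, y) := fun y hy => by
    have h1 : |u y| < t / 2 := by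
      have := hy.2
      simp only [mem_ofPred_eq, not_le] at this
      exact (ENNReal.ofReal_lt_ofReal_iff (by positivity)).1 this
    have hxy : x ≠ y := by
      rintro rfl
      linarith
    have h2 : t / 2 ≤ |u x - u y| := by
      have := abs_sub_abs_le_abs_sub (u x) (u y)
      linarith
    have hyr : ‖x - y‖ < r := by
      have := hy.1
      rw [mem_ball_iff_norm, norm_sub_rev] at this
      exact this
    have hpos : 0 < ‖x - y‖ := norm_pos_iff.2 (sub_ne_zero.2 hxy)
    have hp1 := hp.one_lt x y
    have h3 : (t / 2) ^ (p x x - η) ≤ |u x - u y| ^ p x y :=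
      (Real.rpow_le_rpow_of_exponent_le (by linarith)
        (hpx y (Metric.ball_subset_ball hrr0 hy.1))).trans
        (Real.rpow_le_rpow (by positivity) h2 (by linarith))
    have h4 : r ^ (-((N : ℝ) + s)) ≤ singularKernel s p x y := by
      have h5 : s ≤ s * p x y := le_mul_of_one_le_right hs.le hp1.le
      exact (Real.rpow_le_rpow_of_nonpos hpos hyr.le (by linarith)).trans
        (Real.rpow_le_rpow_of_exponent_ge hpos (by linarith) (by linarith))
    rw [pairDensity, ← ENNReal.ofReal_mul (by positivity)]
    refine ENNReal.ofReal_le_ofReal ?_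
    exact mul_le_mul h3 h4 (by positivity) (by positivity)
  have hint : ENNReal.ofReal (κ * (4 * L / t)) ≤
      ∫⁻ y in Metric.ball x r₀, pairDensity s p u (x, y) := by
    rw [ENNReal.ofReal_mul (by positivity)]
    calc ENNReal.ofReal κ * ENNReal.ofReal (4 * L / t) ≤ ENNReal.ofReal κ * volume A := by gcongr
      _ = ∫⁻ _ in A, ENNReal.ofReal κ := (setLIntegral_const _ _).symm
      _ ≤ ∫⁻ y in A, pairDensity s p u (x, y) := setLIntegral_mono' hAm hlow
      _ ≤ _ := lintegral_mono_set (sdiff_subset.trans (Metric.ball_subset_ball hrr0))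
  refine le_trans ?_ (mul_le_mul_right hint _)
  rw [← ENNReal.ofReal_mul (by positivity)]
  refine ENNReal.ofReal_le_ofReal ?_
  -- Since `r^N = a / t`, the kernel contributes `t^(1+η)`. One factor `t` pays for the volume `4L /
  -- t`, and `t^η` with `η = s / N` makes up for the exponent `p x x - η`. This balance fixes the
  -- tolerated oscillation `s / N`.
  have hrexp : r ^ (-((N : ℝ) + s)) = t ^ (1 + η) / a ^ (1 + η) := by
    rw [hr, ← Real.rpow_mul (by positivity)]
    have : (N : ℝ)⁻¹ * -((N : ℝ) + s) = -(1 + η) := by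
      rw [hη]; field_simp
    rw [this, Real.rpow_neg (by positivity), ← Real.inv_rpow (by positivity), inv_div,
      Real.div_rpow ht0.le ha0.le]
  have haη : 0 < a ^ (1 + η) := Real.rpow_pos_of_pos ha0 _
  have hte : t ^ (1 + η) = t * t ^ η := by rw [Real.rpow_add ht0, Real.rpow_one]
  have h1 : 2 ^ M * a ^ (1 + η) / (4 * L) * (κ * (4 * L / t)) =
      2 ^ M * ((t / 2) ^ (p x x - η) * t ^ η) := by
    rw [hκ, hrexp, hte]
    field_simp
  rw [h1, Real.div_rpow ht0.le zero_le_two]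
  have h2 : (2 : ℝ) ^ (p x x - η) ≤ 2 ^ M :=
    Real.rpow_le_rpow_of_exponent_le one_le_two (by linarith [hM x x])
  have h3 : t ^ p x x = t ^ (p x x - η) * t ^ η := by
    rw [← Real.rpow_add ht0]; ring_nf
  rw [h3]
  have h4 : (0 : ℝ) < 2 ^ (p x x - η) := by positivity
  calc t ^ (p x x - η) * t ^ η
      = 2 ^ (p x x - η) * (t ^ (p x x - η) / 2 ^ (p x x - η) * t ^ η) := by field_simp
    _ ≤ _ := by gcongr

lemma exists_radius (hN : N ≠ 0) (hΩ : Ω ⊆ Metric.ball 0 R)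
    (hp : IsVariableExponent p) (hs : 0 < s) :
    ∃ r₀ : ℝ, 0 < r₀ ∧ r₀ ≤ 1 ∧ ∀ x ∈ Ω, ∀ y ∈ Metric.ball x r₀, p x x - s / N ≤ p x y := by
  have hN0 : (0 : ℝ) < N := by exact_mod_cast Nat.pos_of_ne_zero hN
  have hc : IsCompact (Metric.closedBall (0 : Eucl N) (R + 2) ×ˢ
      Metric.closedBall (0 : Eucl N) (R + 2)) :=
    (isCompact_closedBall _ _).prod (isCompact_closedBall _ _)
  have hu := hc.uniformContinuousOn_of_continuous hp.continuous.continuousOn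
  rw [Metric.uniformContinuousOn_iff] at hu
  obtain ⟨δ, hδ, h⟩ := hu (s / N) (by positivity)
  refine ⟨min δ 1, by positivity, min_le_right _ _, fun x hx y hy => ?_⟩
  have hxR : ‖x‖ < R := mem_ball_zero_iff.1 (hΩ hx)
  have hy1 : dist y x < 1 := lt_of_lt_of_le hy (min_le_right _ _)
  have hyδ : dist y x < δ := lt_of_lt_of_le hy (min_le_left _ _)
  have hyR : ‖y‖ ≤ R + 2 := by
    have := norm_sub_norm_le y x
    rw [dist_eq_norm] at hy1
    linarith
  have hx' : x ∈ Metric.closedBall (0 : Eucl N) (R + 2) :=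
    mem_closedBall_zero_iff.2 (by linarith)
  have := h (x, x) ⟨hx', hx'⟩ (x, y) ⟨hx', mem_closedBall_zero_iff.2 hyR⟩
    (by rw [Prod.dist_eq, dist_self, dist_comm]; exact max_lt hδ hyδ)
  rw [Real.dist_eq] at this
  have := (abs_lt.1 this).2
  dsimp only at this
  linarith

/-- Where `|u| < T` the integrand is at most `T^M` and `Ω` has finite volume. Where `|u| ≥ T` the
estimate `exists_rpow_diag_le` applies pointwise, and Tonelli's theorem turns its integral over `x`
into part of the upper modular. -/
lemma exists_lintegral_rpow_le (hN : N ≠ 0) (hΩm : MeasurableSet Ω)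
    (hΩ : Ω ⊆ Metric.ball 0 R) (hp : IsVariableExponent p) (hM : ∀ x y, p x y ≤ M) (hs : 0 < s)
    (hq : ∀ x ∈ Metric.closedBall 0 (R + 2), ∀ y ∈ Metric.closedBall 0 (R + 2), q ≤ p x y)
    {L : ℝ} (hL : 0 < L) :
    ∃ C : ENNReal, C ≠ ⊤ ∧ ∀ u : Eucl N → ℝ, Measurable u → (∀ᵐ x, x ∉ Ω → u x = 0) →
      ∫⁻ x in Ω, ENNReal.ofReal |u x| ≤ ENNReal.ofReal L →
      ∫⁻ x in Ω, ENNReal.ofReal (|u x| ^ p x x) ≤ C * (1 + upperGag q s p u) := by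
  obtain ⟨r₀, hr0, hr1, hrad⟩ := exists_radius (s := s) hN hΩ hp hs
  obtain ⟨T, C, hT, hC, h⟩ := exists_rpow_diag_le hN hp hM hs hL hr0 hr1
  have hΩv : volume Ω ≠ ⊤ := ((measure_mono hΩ).trans_lt measure_ball_lt_top).ne
  refine ⟨ENNReal.ofReal (T ^ M) * volume Ω + ENNReal.ofReal C,
    ENNReal.add_ne_top.2 ⟨ENNReal.mul_ne_top ENNReal.ofReal_ne_top hΩv, ENNReal.ofReal_ne_top⟩,
    fun u hu hu0 huL => ?_⟩
  have huL' : ∫⁻ x, ENNReal.ofReal |u x| ≤ ENNReal.ofReal L := by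
    rw [← lintegral_indicator hΩm] at huL
    refine le_trans (lintegral_mono_ae ?_) huL
    filter_upwards [hu0] with x hx
    by_cases hxΩ : x ∈ Ω
    · rw [indicator_of_mem hxΩ]
    · rw [hx hxΩ]; simp
  set S : Set (Eucl N × Eucl N) := {z | q ≤ p z.1 z.2} with hS
  have hSm : MeasurableSet S := measurableSet_upperPairs hp q
  have hdm := measurable_pairDensity hp s hu
  have hF : Measurable (S.indicator (pairDensity s p u)) := hdm.indicator hSm
  have hpt : ∀ x ∈ Ω, ENNReal.ofReal (|u x| ^ p x x) ≤ ENNReal.ofReal (T ^ M) +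
      ENNReal.ofReal C * ∫⁻ y, S.indicator (pairDensity s p u) (x, y) := fun x hx => by
    have hp1 := hp.one_lt x x
    by_cases hxT : T ≤ |u x|
    · refine le_add_left ((h u hu huL' x (hrad x hx) hxT).trans (mul_le_mul_right ?_ _))
      rw [← lintegral_indicator measurableSet_ball]
      refine lintegral_mono fun y => ?_
      by_cases hy : y ∈ Metric.ball x r₀
      · have hxR : ‖x‖ < R := mem_ball_zero_iff.1 (hΩ hx)
        have hmem : (x, y) ∈ S := by
          refine hq x (mem_closedBall_zero_iff.2 (by linarith)) y
            (mem_closedBall_zero_iff.2 ?_)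
          have h1 := norm_sub_norm_le y x
          rw [mem_ball_iff_norm] at hy
          linarith
        rw [indicator_of_mem hy, indicator_of_mem hmem]
      · rw [indicator_of_notMem hy]
        exact zero_le
    · push Not at hxT
      refine le_add_right (ENNReal.ofReal_le_ofReal ?_)
      exact (Real.rpow_le_rpow (abs_nonneg _) hxT.le (by linarith)).trans
        (Real.rpow_le_rpow_of_exponent_le hT (hM x x))
  calc ∫⁻ x in Ω, ENNReal.ofReal (|u x| ^ p x x)
      ≤ ∫⁻ x in Ω, (ENNReal.ofReal (T ^ M) +
          ENNReal.ofReal C * ∫⁻ y, S.indicator (pairDensity s p u) (x, y)) :=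
        setLIntegral_mono' hΩm hpt
    _ = ENNReal.ofReal (T ^ M) * volume Ω +
          ENNReal.ofReal C * ∫⁻ x in Ω, ∫⁻ y, S.indicator (pairDensity s p u) (x, y) := by
        rw [lintegral_add_left measurable_const, setLIntegral_const,
          lintegral_const_mul _ hF.lintegral_prod_right']
    _ ≤ ENNReal.ofReal (T ^ M) * volume Ω + ENNReal.ofReal C * upperGag q s p u := by
        gcongr
        rw [upperGag, ← lintegral_indicator hSm, Measure.volume_eq_prod,
          lintegral_prod _ hF.aemeasurable]
        exact setLIntegral_le_lintegral _ _
    _ ≤ _ := by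
        rw [mul_add, mul_one, add_mul]
        exact add_le_add (self_le_add_right _ _) (self_le_add_left _ _)

end

/-! ### Pairs with small exponent, and the resulting modular bounds -/

section

variable {N : ℕ} {Ω : Set (Eucl N)} {p : Eucl N → Eucl N → ℝ} {s q M R : ℝ}

/-- An integrable radial function that dominates the singular kernel away from the diagonal. -/
def farKernel (N : ℕ) (s : ℝ) (h : Eucl N) : ENNReal :=
  ENNReal.ofReal (2 ^ ((N : ℝ) + s)) * ENNReal.ofReal ((1 + ‖h‖) ^ (-((N : ℝ) + s)))

lemma measurable_farKernel : Measurable (farKernel N s) := by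
  have : Measurable fun h : Eucl N => (1 + ‖h‖) ^ (-((N : ℝ) + s)) :=
    (measurable_norm.const_add 1).pow_const _
  exact this.ennreal_ofReal.const_mul _

lemma lintegral_farKernel_ne_top (hs : 0 < s) : ∫⁻ h, farKernel N s h ≠ ⊤ := by
  have : Measurable fun h : Eucl N => (1 + ‖h‖) ^ (-((N : ℝ) + s)) :=
    (measurable_norm.const_add 1).pow_const _
  simp only [farKernel]
  rw [lintegral_const_mul _ this.ennreal_ofReal]
  refine ENNReal.mul_ne_top ENNReal.ofReal_ne_top (finite_integral_one_add_norm ?_).ne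
  rw [finrank_euclideanSpace_fin]
  linarith

/-- As `p > 1`, the kernel decays at least like `|h|^(-(N+s))`, which is integrable at infinity even
if `p` tends to `1` there. The factor `2^(N+s)` comes from `|h| ≥ (1 + |h|) / 2`. -/
lemma singularKernel_le_farKernel (hp : IsVariableExponent p) (hs : 0 < s) {x y : Eucl N}
    (h : 1 ≤ ‖x - y‖) : ENNReal.ofReal (singularKernel s p x y) ≤ farKernel N s (x - y) := by
  rw [farKernel, ← ENNReal.ofReal_mul (by positivity)]
  refine ENNReal.ofReal_le_ofReal ?_
  have hp1 := hp.one_lt x y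
  have h5 : s ≤ s * p x y := le_mul_of_one_le_right hs.le hp1.le
  have h0 : 0 < ‖x - y‖ := by linarith
  calc singularKernel s p x y ≤ ‖x - y‖ ^ (-((N : ℝ) + s)) :=
        Real.rpow_le_rpow_of_exponent_le h (by linarith)
    _ ≤ ((1 + ‖x - y‖) / 2) ^ (-((N : ℝ) + s)) :=
        Real.rpow_le_rpow_of_nonpos (by linarith) (by linarith)
          (by linarith [(Nat.cast_nonneg N : (0 : ℝ) ≤ N)])
    _ = _ := by
        rw [Real.div_rpow (by positivity) zero_le_two, Real.rpow_neg zero_le_two, div_inv_eq_mul,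
          mul_comm]

lemma abs_rpow_le_one_add {t a b : ℝ} (ha : 0 ≤ a) (hab : a ≤ b) :
    |t| ^ a ≤ 1 + |t| ^ b := by
  rcases le_total |t| 1 with h | h
  · have := Real.rpow_le_one (abs_nonneg t) h ha
    have : 0 ≤ |t| ^ b := by positivity
    linarith
  · have := Real.rpow_le_rpow_of_exponent_le h hab
    linarith

/-- For points `x` in `Ω` and `y` outside a large ball, small exponents are harmless. -/
lemma pairDensity_far_le (hp : IsVariableExponent p) (hs : 0 < s) (hΩ : Ω ⊆ Metric.ball 0 R)
    (hq : ∀ x ∈ Metric.closedBall 0 (R + 2), ∀ y ∈ Metric.closedBall 0 (R + 2), q ≤ p x y)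
    {u : Eucl N → ℝ} {x y : Eucl N} (hx : x ∈ Ω) (hy : y ∉ Ω → u y = 0) (hpq : p x y < q) :
    pairDensity s p u (x, y) ≤
      ENNReal.ofReal (1 + |u x| ^ p x x) * farKernel N s (x - y) := by
  have hxR : ‖x‖ < R := mem_ball_zero_iff.1 (hΩ hx)
  have hx' : x ∈ Metric.closedBall (0 : Eucl N) (R + 2) :=
    mem_closedBall_zero_iff.2 (by linarith)
  -- An exponent below `q` forces `y` out of the large ball. So `u y = 0`, the pair is at distance
  -- at least `1`, and `p x y < q ≤ p x x`.
  have hyR : R + 2 < ‖y‖ := by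
    by_contra hcon
    exact absurd (hq x hx' y (mem_closedBall_zero_iff.2 (not_lt.1 hcon))) (not_le.2 hpq)
  have hy0 : u y = 0 := hy fun h => by
    have := mem_ball_zero_iff.1 (hΩ h)
    linarith
  have h1 : 1 ≤ ‖x - y‖ := by
    have := norm_sub_norm_le y x
    rw [norm_sub_rev] at this
    linarith
  have hp1 := hp.one_lt x y
  rw [pairDensity]
  dsimp only
  rw [hy0, sub_zero]
  gcongr
  · exact abs_rpow_le_one_add (by linarith) (hpq.le.trans (hq x hx' x hx'))
  · exact singularKernel_le_farKernel hp hs h1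

lemma pairDensity_swap (hp : IsVariableExponent p) (u : Eucl N → ℝ) (x y : Eucl N) :
    pairDensity s p u (x, y) = pairDensity s p u (y, x) := by
  simp only [pairDensity, singularKernel]
  rw [hp.symm y x, abs_sub_comm, norm_sub_rev]

/-- Off `{p ≥ q}` either both points lie outside `Ω` and the density vanishes, or one lies in `Ω`
and `pairDensity_far_le` applies, after a swap if necessary. Integrating the translated far kernel
over the other point gives a constant. -/
lemma exists_lintegral_pairDensity_le (hΩm : MeasurableSet Ω) (hΩ : Ω ⊆ Metric.ball 0 R)
    (hp : IsVariableExponent p) (hs : 0 < s)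
    (hq : ∀ x ∈ Metric.closedBall 0 (R + 2), ∀ y ∈ Metric.closedBall 0 (R + 2), q ≤ p x y) :
    ∃ C : ENNReal, C ≠ ⊤ ∧ ∀ u : Eucl N → ℝ, Measurable u → (∀ᵐ x, x ∉ Ω → u x = 0) →
      ∫⁻ z, pairDensity s p u z ≤
        upperGag q s p u + C * (volume Ω + ∫⁻ x in Ω, ENNReal.ofReal (|u x| ^ p x x)) := by
  set I : ENNReal := ∫⁻ h, farKernel N s h with hI
  refine ⟨I + I, ENNReal.add_ne_top.2
    ⟨lintegral_farKernel_ne_top hs, lintegral_farKernel_ne_top hs⟩, fun u hu hu0 => ?_⟩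
  have hpm : Measurable fun x : Eucl N => p x x :=
    (hp.continuous.comp (continuous_id.prodMk continuous_id)).measurable
  set g : Eucl N → ENNReal := Ω.indicator fun x => ENNReal.ofReal (1 + |u x| ^ p x x) with hg
  have hgm : Measurable g :=
    (((measurable_norm.comp hu).pow hpm).const_add 1).ennreal_ofReal.indicator hΩm
  have hkm := measurable_farKernel (N := N) (s := s)
  have hgint : ∫⁻ x, g x = volume Ω + ∫⁻ x in Ω, ENNReal.ofReal (|u x| ^ p x x) := by
    rw [hg, lintegral_indicator hΩm, ← setLIntegral_one, ← lintegral_add_left measurable_const]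
    refine lintegral_congr fun x => ?_
    rw [ENNReal.ofReal_add zero_le_one (by positivity), ENNReal.ofReal_one]
  have hm1 : Measurable fun z : Eucl N × Eucl N => g z.1 * farKernel N s (z.1 - z.2) :=
    (hgm.comp measurable_fst).mul (hkm.comp (measurable_fst.sub measurable_snd))
  have hm2 : Measurable fun z : Eucl N × Eucl N => g z.2 * farKernel N s (z.2 - z.1) :=
    (hgm.comp measurable_snd).mul (hkm.comp (measurable_snd.sub measurable_fst))
  set S : Set (Eucl N × Eucl N) := {z | q ≤ p z.1 z.2} with hS
  have hSm : MeasurableSet S := measurableSet_upperPairs hp q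
  rw [← lintegral_add_compl _ hSm]
  refine add_le_add le_rfl ?_
  have hpt : ∀ᵐ z ∂(volume : Measure (Eucl N × Eucl N)).restrict Sᶜ, pairDensity s p u z ≤
      g z.1 * farKernel N s (z.1 - z.2) + g z.2 * farKernel N s (z.2 - z.1) := by
    filter_upwards [ae_pair hu0 _, ae_restrict_mem hSm.compl] with z h1 h2
    have hpq : p z.1 z.2 < q := not_le.1 h2
    by_cases hx : z.1 ∈ Ω
    · refine le_add_right ?_
      rw [hg, indicator_of_mem hx]
      exact pairDensity_far_le hp hs hΩ hq hx h1.2 hpq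
    · by_cases hy : z.2 ∈ Ω
      · refine le_add_left ?_
        rw [hg, indicator_of_mem hy, show z = (z.1, z.2) from rfl, pairDensity_swap hp]
        exact pairDensity_far_le hp hs hΩ hq hy h1.1 (by rwa [hp.symm])
      · have hp1 := hp.one_lt z.1 z.2
        rw [pairDensity, h1.1 hx, h1.2 hy, sub_zero, abs_zero, Real.zero_rpow (by linarith)]
        simp
  refine (lintegral_mono_ae hpt).trans ((setLIntegral_le_lintegral _ _).trans (le_of_eq ?_))
  rw [lintegral_add_left hm1, Measure.volume_eq_prod, lintegral_prod _ hm1.aemeasurable,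
    lintegral_prod_symm _ hm2.aemeasurable, add_mul, ← hgint]
  have hx : ∀ x, ∫⁻ y, g x * farKernel N s (x - y) = g x * I := fun x => by
    have hxm : Measurable fun y => farKernel N s (x - y) :=
      hkm.comp (measurable_const.sub measurable_id)
    rw [lintegral_const_mul _ hxm, lintegral_sub_left_eq_self (farKernel N s) x]
  simp only [hx]
  rw [lintegral_mul_const _ hgm, mul_comm I]

/-- Chains the three estimates: upper modular to `L¹`, then to `∫ |u|^p(x,x)`, then to the full
Gagliardo modular. It links the abstract scheme with the norm of `X_0`. -/
lemma exists_modular_bound (hN : N ≠ 0) (hΩm : MeasurableSet Ω) (hR : 0 < R)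
    (hΩ : Ω ⊆ Metric.ball 0 R) (hp : IsVariableExponent p) (hM : ∀ x y, p x y ≤ M) (hs : 0 < s)
    (hq : ∀ x ∈ Metric.closedBall 0 (R + 2), ∀ y ∈ Metric.closedBall 0 (R + 2), q ≤ p x y)
    (B : ℝ) :
    ∃ C : ℝ, 1 ≤ C ∧ ∀ u : Eucl N → ℝ, Measurable u → (∀ᵐ x, x ∉ Ω → u x = 0) →
      upperGag q s p u ≤ ENNReal.ofReal B →
      ∫⁻ x in Ω, ENNReal.ofReal (|u x| ^ p x x) ≤ ENNReal.ofReal C ∧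
      ∫⁻ z, pairDensity s p u z ≤ ENNReal.ofReal C := by
  have hΩv : volume Ω ≠ ⊤ := ((measure_mono hΩ).trans_lt measure_ball_lt_top).ne
  obtain ⟨C₁, hC₁, h₁⟩ := exists_lintegral_abs_le hN hΩm hR hΩ hp hM hs hq
  set A : ENNReal := volume Ω + C₁ * ENNReal.ofReal B with hA
  have hAt : A ≠ ⊤ := ENNReal.add_ne_top.2 ⟨hΩv, ENNReal.mul_ne_top hC₁ ENNReal.ofReal_ne_top⟩
  obtain ⟨C₂, hC₂, h₂⟩ := exists_lintegral_rpow_le hN hΩm hΩ hp hM hs hq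
    (L := A.toReal + 1) (by positivity)
  obtain ⟨C₃, hC₃, h₃⟩ := exists_lintegral_pairDensity_le hΩm hΩ hp hs hq
  set A₂ : ENNReal := C₂ * (1 + ENNReal.ofReal B) with hA₂
  have hA₂t : A₂ ≠ ⊤ :=
    ENNReal.mul_ne_top hC₂ (ENNReal.add_ne_top.2 ⟨ENNReal.one_ne_top, ENNReal.ofReal_ne_top⟩)
  set A₃ : ENNReal := ENNReal.ofReal B + C₃ * (volume Ω + A₂) with hA₃
  have hA₃t : A₃ ≠ ⊤ := ENNReal.add_ne_top.2 ⟨ENNReal.ofReal_ne_top,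
    ENNReal.mul_ne_top hC₃ (ENNReal.add_ne_top.2 ⟨hΩv, hA₂t⟩)⟩
  refine ⟨max 1 (max A₂.toReal A₃.toReal), le_max_left _ _, fun u hu hu0 huB => ?_⟩
  have e1 : ∫⁻ x in Ω, ENNReal.ofReal |u x| ≤ ENNReal.ofReal (A.toReal + 1) := by
    refine (h₁ u hu hu0 1 one_pos le_rfl).trans ?_
    rw [Real.one_rpow, ENNReal.ofReal_one, one_mul, mul_one,
      ENNReal.ofReal_add ENNReal.toReal_nonneg zero_le_one, ENNReal.ofReal_toReal hAt]
    refine le_add_right ?_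
    rw [hA]
    gcongr
  have e2 : ∫⁻ x in Ω, ENNReal.ofReal (|u x| ^ p x x) ≤ A₂ := by
    refine (h₂ u hu hu0 e1).trans ?_
    rw [hA₂]
    gcongr
  have e3 : ∫⁻ z, pairDensity s p u z ≤ A₃ := by
    refine (h₃ u hu hu0).trans ?_
    rw [hA₃]
    gcongr
  constructor
  · rw [← ENNReal.ofReal_toReal hA₂t] at e2
    exact e2.trans (ENNReal.ofReal_le_ofReal ((le_max_left _ _).trans (le_max_right _ _)))
  · rw [← ENNReal.ofReal_toReal hA₃t] at e3
    exact e3.trans (ENNReal.ofReal_le_ofReal ((le_max_right _ _).trans (le_max_right _ _)))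

/-- The `L¹` norm is arbitrarily small once the modular is small enough. -/
lemma exists_lintegral_abs_le_real (hN : N ≠ 0) (hΩm : MeasurableSet Ω) (hR : 0 < R)
    (hΩ : Ω ⊆ Metric.ball 0 R) (hp : IsVariableExponent p) (hM : ∀ x y, p x y ≤ M) (hs : 0 < s)
    (hq : ∀ x ∈ Metric.closedBall 0 (R + 2), ∀ y ∈ Metric.closedBall 0 (R + 2), q ≤ p x y)
    {δ : ℝ} (hδ : 0 < δ) :
    ∃ e : ℝ, 0 < e ∧ ∀ u : Eucl N → ℝ, Measurable u → (∀ᵐ x, x ∉ Ω → u x = 0) →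
      upperGag q s p u ≤ ENNReal.ofReal e → ∫⁻ x, ENNReal.ofReal |u x| ≤ ENNReal.ofReal δ := by
  have hΩv : volume Ω ≠ ⊤ := ((measure_mono hΩ).trans_lt measure_ball_lt_top).ne
  obtain ⟨C, hC, h⟩ := exists_lintegral_abs_le hN hΩm hR hΩ hp hM hs hq
  set V := (volume Ω).toReal with hV
  have hV0 : 0 ≤ V := ENNReal.toReal_nonneg
  have hC0 : 0 ≤ C.toReal := ENNReal.toReal_nonneg
  -- First `ε` makes the volume term at most `δ / 2`; with `ε` fixed, the bound on the modular makes
  -- the other term at most `δ / 2`.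
  set ε := min 1 (δ / (2 * (V + 1))) with hε
  have hε0 : 0 < ε := by positivity
  have hεM : 0 < ε ^ (1 - M) := Real.rpow_pos_of_pos hε0 _
  refine ⟨δ / (2 * ((C.toReal + 1) * ε ^ (1 - M))), by positivity, fun u hu hu0 hue => ?_⟩
  have h1 : ∫⁻ x, ENNReal.ofReal |u x| = ∫⁻ x in Ω, ENNReal.ofReal |u x| := by
    rw [← lintegral_indicator hΩm]
    refine lintegral_congr_ae ?_
    filter_upwards [hu0] with x hx
    by_cases hxΩ : x ∈ Ω
    · rw [indicator_of_mem hxΩ]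
    · rw [hx hxΩ, indicator_of_notMem hxΩ]; simp
  rw [h1]
  calc _ ≤ _ := h u hu hu0 ε hε0 (min_le_left _ _)
    _ ≤ ENNReal.ofReal ε * ENNReal.ofReal V + ENNReal.ofReal C.toReal *
        ENNReal.ofReal (ε ^ (1 - M)) *
          ENNReal.ofReal (δ / (2 * ((C.toReal + 1) * ε ^ (1 - M)))) := by
        rw [ENNReal.ofReal_toReal hC, hV, ENNReal.ofReal_toReal hΩv]
        gcongr
    _ = ENNReal.ofReal (ε * V + C.toReal * ε ^ (1 - M) *
          (δ / (2 * ((C.toReal + 1) * ε ^ (1 - M))))) := by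
        rw [← ENNReal.ofReal_mul hε0.le, ← ENNReal.ofReal_mul hC0,
          ← ENNReal.ofReal_mul (by positivity), ← ENNReal.ofReal_add (by positivity)
          (by positivity)]
    _ ≤ ENNReal.ofReal δ := by
        refine ENNReal.ofReal_le_ofReal ?_
        have a1 : ε * V ≤ δ / 2 := by
          calc ε * V ≤ δ / (2 * (V + 1)) * (V + 1) := by
                gcongr
                · exact min_le_right _ _
                · linarith
            _ = δ / 2 := by field_simp
        have a2 : C.toReal * ε ^ (1 - M) * (δ / (2 * ((C.toReal + 1) * ε ^ (1 - M)))) ≤ δ / 2 := by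
          calc _ ≤ (C.toReal + 1) * ε ^ (1 - M) * (δ / (2 * ((C.toReal + 1) * ε ^ (1 - M)))) := by
                gcongr
                linarith
            _ = δ / 2 := by field_simp
        linarith

end

/-! ### `X_0` as a complete modular system -/

section

variable {N : ℕ} {Ω : Set (Eucl N)} {p : Eucl N → Eucl N → ℝ} {s q M R : ℝ}

/-- The measure `K(x,y) dx dy` on pairs. -/
def pairMeasure {N : ℕ} (s : ℝ) (p : Eucl N → Eucl N → ℝ) : Measure (Eucl N × Eucl N) :=
  volume.withDensity fun z => ENNReal.ofReal (singularKernel s p z.1 z.2)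

/-- The difference `u(x) - u(y)` of an element of `X_0`. -/
def pairDiff {hp : IsVariableExponent p} (u : X0 Ω s hp) (z : Eucl N × Eucl N) : ℝ :=
  (u : Eucl N →ₘ[volume] ℝ) z.1 - (u : Eucl N →ₘ[volume] ℝ) z.2

lemma setLIntegral_pairMeasure (hp : IsVariableExponent p) (s : ℝ) {w : Eucl N → ℝ}
    (hw : Measurable w) {S : Set (Eucl N × Eucl N)} (hS : MeasurableSet S) :
    ∫⁻ z in S, ENNReal.ofReal (|w z.1 - w z.2| ^ p z.1 z.2) ∂pairMeasure s p =
      ∫⁻ z in S, pairDensity s p w z := by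
  have h3 : Measurable fun z : Eucl N × Eucl N => w z.1 - w z.2 :=
    (hw.comp measurable_fst).sub (hw.comp measurable_snd)
  have hm : Measurable fun z : Eucl N × Eucl N =>
      ENNReal.ofReal (|w z.1 - w z.2| ^ p z.1 z.2) :=
    ((measurable_norm.comp h3).pow hp.continuous.measurable).ennreal_ofReal
  rw [pairMeasure, restrict_withDensity hS, lintegral_withDensity_eq_lintegral_mul _
    (singularKernel_measurable hp s).ennreal_ofReal hm]
  refine lintegral_congr fun z => ?_
  rw [Pi.mul_apply, mul_comm]
  rfl

lemma ae_pairMeasure_of_ae {P : Eucl N × Eucl N → Prop}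
    (h : ∀ᵐ z ∂(volume : Measure (Eucl N × Eucl N)), P z) : ∀ᵐ z ∂pairMeasure s p, P z :=
  (withDensity_absolutelyContinuous _ _).ae_le h

lemma ae_pair_pairMeasure {P : Eucl N → Prop} (h : ∀ᵐ x : Eucl N, P x) :
    ∀ᵐ z ∂pairMeasure s p, P z.1 ∧ P z.2 := by
  refine ae_pairMeasure_of_ae ?_
  have := ae_pair h univ
  rwa [Measure.restrict_univ] at this

lemma measurableSet_crossSet (hΩm : MeasurableSet Ω) : MeasurableSet (crossSet Ω) :=
  (hΩm.compl.prod hΩm.compl).compl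

variable {hp : IsVariableExponent p}

/-- Off `Q` both values of `u` vanish almost everywhere. On `Q`, finiteness for some `l` implies
finiteness for `l = 1`, since bounded exponents give `l^p ≤ (1 + l)^M`. -/
lemma lintegral_pairDensity_ne_top (hΩm : MeasurableSet Ω) (hM : ∀ x y, p x y ≤ M)
    (u : X0 Ω s hp) : ∫⁻ z, pairDensity s p (u : Eucl N →ₘ[volume] ℝ) z ≠ ⊤ := by
  obtain ⟨⟨-, l, hl, hfin⟩, hu0⟩ := u.2
  set w : Eucl N →ₘ[volume] ℝ := u.1 with hw
  have hzero : ∫⁻ z in (crossSet Ω)ᶜ, pairDensity s p w z = 0 := by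
    rw [lintegral_congr_ae (g := fun _ => 0)]
    · simp
    · filter_upwards [ae_pair hu0 _, ae_restrict_mem (measurableSet_crossSet hΩm).compl]
        with z h1 h2
      have h3 : z.1 ∉ Ω ∧ z.2 ∉ Ω := by simpa [crossSet] using h2
      have hp1 := hp.one_lt z.1 z.2
      rw [pairDensity, h1.1 h3.1, h1.2 h3.2, sub_zero, abs_zero, Real.zero_rpow (by linarith)]
      simp
  rw [← lintegral_add_compl _ (measurableSet_crossSet hΩm), hzero, add_zero]
  have hle : ∫⁻ z in crossSet Ω, pairDensity s p w z ≤
      ENNReal.ofReal ((1 + l) ^ M) * gagModular Ω p (singularKernel s p) w l := by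
    rw [gagModular, ← lintegral_const_mul' _ _ ENNReal.ofReal_ne_top]
    refine lintegral_mono fun z => ?_
    have hp1 := hp.one_lt z.1 z.2
    have hlp : 0 < l ^ p z.1 z.2 := Real.rpow_pos_of_pos hl _
    rw [pairDensity, ← mul_assoc, ← ENNReal.ofReal_mul (p := (1 + l) ^ M) (by positivity)]
    refine mul_le_mul_left (ENNReal.ofReal_le_ofReal ?_) _
    have h1 : l ^ p z.1 z.2 ≤ (1 + l) ^ M :=
      (Real.rpow_le_rpow hl.le (by linarith) (by linarith)).trans
        (Real.rpow_le_rpow_of_exponent_le (by linarith) (hM _ _))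
    rw [mul_div_assoc', le_div_iff₀ hlp, mul_comm]
    gcongr
  exact (hle.trans_lt (ENNReal.mul_lt_top ENNReal.ofReal_lt_top hfin)).ne

lemma modularSystem (hΩm : MeasurableSet Ω) (hM : ∀ x y, p x y ≤ M) :
    ModularSystem (pairMeasure s p) (pairDiff (Ω := Ω) (s := s) (hp := hp))
      (fun z => p z.1 z.2) M where
  measurable_exponent := hp.continuous.measurable
  one_lt z := hp.one_lt _ _
  le_bound z := hM _ _
  measurable u := (u.1.measurable.comp measurable_fst).sub (u.1.measurable.comp measurable_snd)
  add u v := by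
    filter_upwards [ae_pair_pairMeasure (AEEqFun.coeFn_add u.1 v.1)] with z h
    simp only [pairDiff, Submodule.coe_add, h.1, h.2, Pi.add_apply]
    ring
  smul c u := by
    filter_upwards [ae_pair_pairMeasure (AEEqFun.coeFn_smul c u.1)] with z h
    simp only [pairDiff, Submodule.coe_smul, h.1, h.2, Pi.smul_apply, smul_eq_mul]
    ring
  integrable u := by
    have hm : Measurable (pairDiff u) :=
      (u.1.measurable.comp measurable_fst).sub (u.1.measurable.comp measurable_snd)
    have h1 := setLIntegral_pairMeasure hp s u.1.measurable MeasurableSet.univ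
    rw [Measure.restrict_univ, Measure.restrict_univ] at h1
    refine ⟨((measurable_norm.comp hm).pow hp.continuous.measurable).aestronglyMeasurable, ?_⟩
    rw [hasFiniteIntegral_iff_ofReal (Eventually.of_forall fun z => by positivity)]
    exact lt_of_eq_of_lt h1 (lintegral_pairDensity_ne_top hΩm hM u).lt_top

lemma ofReal_upperModular (hΩm : MeasurableSet Ω) (hM : ∀ x y, p x y ≤ M) (q : ℝ)
    (u : X0 Ω s hp) :
    ENNReal.ofReal (upperModular (pairMeasure s p) pairDiff (fun z => p z.1 z.2) q u) =
      upperGag q s p (u : Eucl N →ₘ[volume] ℝ) := by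
  rw [upperModular, ofReal_integral_eq_lintegral_ofReal
    ((modularSystem hΩm hM).integrable u).integrableOn
    (Eventually.of_forall fun z => by positivity)]
  exact setLIntegral_pairMeasure hp s u.1.measurable (measurableSet_upperPairs hp q)

lemma upperGag_le (hΩm : MeasurableSet Ω) (hM : ∀ x y, p x y ≤ M) {u : X0 Ω s hp} {B : ℝ}
    (h : upperModular (pairMeasure s p) pairDiff (fun z => p z.1 z.2) q u ≤ B) :
    upperGag q s p (u : Eucl N →ₘ[volume] ℝ) ≤ ENNReal.ofReal B := by
  rw [← ofReal_upperModular hΩm hM]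
  exact ENNReal.ofReal_le_ofReal h

lemma div_rpow_le_inv_mul {t C r : ℝ} (ht : 0 ≤ t) (hC : 1 ≤ C) (hr : 1 ≤ r) :
    t / C ^ r ≤ C⁻¹ * t := by
  have h1 : C ≤ C ^ r := by
    simpa using Real.rpow_le_rpow_of_exponent_le hC hr
  rw [inv_mul_eq_div]
  exact div_le_div_of_nonneg_left ht (by linarith) h1

/-- Modulars bounded by `C ≥ 1` give a norm bounded by `2 C`. -/
lemma normK_le (hp : IsVariableExponent p) {u : Eucl N → ℝ} {C : ℝ}
    (hC : 1 ≤ C) (h1 : ∫⁻ x in Ω, ENNReal.ofReal (|u x| ^ p x x) ≤ ENNReal.ofReal C)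
    (h2 : ∫⁻ z, pairDensity s p u z ≤ ENNReal.ofReal C) :
    normK Ω p (singularKernel s p) u ≤ C + C := by
  have hC0 : 0 < C := by linarith
  have hinv : ENNReal.ofReal C⁻¹ * ENNReal.ofReal C = 1 := by
    rw [← ENNReal.ofReal_mul (by positivity), inv_mul_cancel₀ hC0.ne', ENNReal.ofReal_one]
  refine add_le_add (csInf_le ⟨0, fun l hl => hl.1.le⟩ ⟨hC0, ?_⟩)
    (csInf_le ⟨0, fun l hl => hl.1.le⟩ ⟨hC0, ?_⟩)
  · calc lebModular Ω p u C
        ≤ ∫⁻ x in Ω, ENNReal.ofReal C⁻¹ * ENNReal.ofReal (|u x| ^ p x x) := by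
          refine lintegral_mono fun x => ?_
          rw [← ENNReal.ofReal_mul (by positivity)]
          exact ENNReal.ofReal_le_ofReal
            (div_rpow_le_inv_mul (by positivity) hC (hp.one_lt x x).le)
      _ ≤ ENNReal.ofReal C⁻¹ * ENNReal.ofReal C := by
          rw [lintegral_const_mul' _ _ ENNReal.ofReal_ne_top]
          gcongr
      _ ≤ 1 := hinv.le
  · calc gagModular Ω p (singularKernel s p) u C
        ≤ ∫⁻ z in crossSet Ω, ENNReal.ofReal C⁻¹ * pairDensity s p u z := by
          refine lintegral_mono fun z => ?_
          rw [pairDensity, ← mul_assoc, ← ENNReal.ofReal_mul (p := C⁻¹) (by positivity)]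
          exact mul_le_mul_left (ENNReal.ofReal_le_ofReal
            (div_rpow_le_inv_mul (by positivity) hC (hp.one_lt _ _).le)) _
      _ ≤ ENNReal.ofReal C⁻¹ * ENNReal.ofReal C := by
          rw [lintegral_const_mul' _ _ ENNReal.ofReal_ne_top]
          exact mul_le_mul_right ((setLIntegral_le_lintegral _ _).trans h2) _
      _ ≤ 1 := hinv.le

lemma normK_nonneg (K : Eucl N → Eucl N → ℝ) (u : Eucl N → ℝ) : 0 ≤ normK Ω p K u :=
  add_nonneg (Real.sInf_nonneg fun _ hl => hl.1.le) (Real.sInf_nonneg fun _ hl => hl.1.le)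

lemma lintegral_le_of_ae_tendsto {Z : Type*} [MeasurableSpace Z] {μ : Measure Z}
    {g : ℕ → Z → ENNReal} {h : Z → ENNReal} {c : ENNReal} (hgm : ∀ k, Measurable (g k))
    (hlim : ∀ᵐ z ∂μ, Tendsto (fun k => g k z) atTop (𝓝 (h z)))
    (hc : ∀ k, ∫⁻ z, g k z ∂μ ≤ c) : ∫⁻ z, h z ∂μ ≤ c :=
  calc ∫⁻ z, h z ∂μ = ∫⁻ z, liminf (fun k => g k z) atTop ∂μ := by
        refine lintegral_congr_ae ?_
        filter_upwards [hlim] with z hz using hz.liminf_eq.symm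
    _ ≤ liminf (fun k => ∫⁻ z, g k z ∂μ) atTop := lintegral_liminf_le hgm
    _ ≤ c := liminf_le_of_le (by isBoundedDefault) fun b hb => by
        obtain ⟨k, hk⟩ := hb.exists
        exact hk.trans (hc k)

/-- Almost everywhere limits of sequences with bounded modulars belong to the space. -/
lemma mem_X0_of_ae_tendsto {u : ℕ → X0 Ω s hp} {w : Eucl N →ₘ[volume] ℝ} {C : ℝ}
    (hlim : ∀ᵐ x, Tendsto (fun k => (u k : Eucl N →ₘ[volume] ℝ) x) atTop (𝓝 (w x)))
    (h1 : ∀ k, ∫⁻ x in Ω, ENNReal.ofReal (|(u k : Eucl N →ₘ[volume] ℝ) x| ^ p x x) ≤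
      ENNReal.ofReal C)
    (h2 : ∀ k, ∫⁻ z, pairDensity s p (u k : Eucl N →ₘ[volume] ℝ) z ≤ ENNReal.ofReal C) :
    w ∈ X0 Ω s hp := by
  have hpow : ∀ {g : ℕ → ℝ} {a r : ℝ}, 1 < r → Tendsto g atTop (𝓝 a) →
      Tendsto (fun k => ENNReal.ofReal (|g k| ^ r)) atTop (𝓝 (ENNReal.ofReal (|a| ^ r))) :=
    fun hr h => (ENNReal.continuous_ofReal.tendsto _).comp
      (h.abs.rpow_const (Or.inr (by linarith)))
  refine ⟨⟨?_, 1, one_pos, ?_⟩, ?_⟩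
  · refine lt_of_le_of_lt (lintegral_le_of_ae_tendsto
      (fun k => ofReal_rpow_measurable hp (u k).1) (ae_restrict_of_ae ?_) h1)
      ENNReal.ofReal_lt_top
    filter_upwards [hlim] with x hx using hpow (hp.one_lt x x) hx
  · have h3 : ∫⁻ z, pairDensity s p w z ≤ ENNReal.ofReal C := by
      refine lintegral_le_of_ae_tendsto
        (fun k => measurable_pairDensity hp s (u k).1.measurable) ?_ h2
      have := ae_pair hlim univ
      rw [Measure.restrict_univ] at this
      filter_upwards [this] with z hz
      exact ENNReal.Tendsto.mul_const (hpow (hp.one_lt _ _) (hz.1.sub hz.2))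
        (Or.inr ENNReal.ofReal_ne_top)
    refine lt_of_le_of_lt ?_ (h3.trans_lt ENNReal.ofReal_lt_top)
    refine le_trans (lintegral_mono fun z => ?_) (setLIntegral_le_lintegral (crossSet Ω) _)
    simp only [Real.one_rpow, div_one]
    exact le_rfl
  · filter_upwards [hlim, ae_all_iff.2 fun k => (u k).2.2] with x hx h0 hxΩ
    refine tendsto_nhds_unique hx ?_
    simp only [h0 _ hxΩ]
    exact tendsto_const_nhds

/-- Cauchy for the upper modular implies Cauchy in `L¹`, which is complete, and a subsequence
converges almost everywhere. The uniform bounds of `exists_modular_bound` and Fatou's lemma keep the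
limit in `X_0`. -/
lemma isComplete_pairDiff (hN : N ≠ 0) (hΩm : MeasurableSet Ω) (hR : 0 < R)
    (hΩ : Ω ⊆ Metric.ball 0 R) (hM : ∀ x y, p x y ≤ M) (hs : 0 < s)
    (hq : ∀ x ∈ Metric.closedBall 0 (R + 2), ∀ y ∈ Metric.closedBall 0 (R + 2), q ≤ p x y) :
    ModularSystem.IsComplete (pairMeasure s p) (pairDiff (Ω := Ω) (s := s) (hp := hp))
      (fun z => p z.1 z.2) q := by
  intro u B hB hcauchy
  obtain ⟨C, -, hC⟩ := exists_modular_bound hN hΩm hR hΩ hp hM hs hq B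
  have hbd := fun n => hC (u n).1 (u n).1.measurable (u n).2.2 (upperGag_le hΩm hM (hB n))
  obtain ⟨C₁, hC₁, hL1⟩ := exists_lintegral_abs_le hN hΩm hR hΩ hp hM hs hq
  have hΩv : volume Ω ≠ ⊤ := ((measure_mono hΩ).trans_lt measure_ball_lt_top).ne
  have hnorm : ∀ f : Eucl N → ℝ, eLpNorm f 1 volume = ∫⁻ x, ENNReal.ofReal |f x| := fun f => by
    rw [eLpNorm_one_eq_lintegral_enorm]
    refine lintegral_congr fun x => ?_
    rw [← ofReal_norm, Real.norm_eq_abs]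
  have hmem : ∀ n, MemLp (u n : Eucl N →ₘ[volume] ℝ) 1 volume := fun n => by
    refine ⟨(u n).1.aestronglyMeasurable, ?_⟩
    have h1 : ∫⁻ x, ENNReal.ofReal |(u n).1 x| = ∫⁻ x in Ω, ENNReal.ofReal |(u n).1 x| := by
      rw [← lintegral_indicator hΩm]
      refine lintegral_congr_ae ?_
      filter_upwards [(u n).2.2] with x hx
      by_cases hxΩ : x ∈ Ω
      · rw [indicator_of_mem hxΩ]
      · rw [hx hxΩ, indicator_of_notMem hxΩ]; simp
    rw [hnorm, h1]
    refine (hL1 _ (u n).1.measurable (u n).2.2 1 one_pos le_rfl).trans_lt ?_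
    refine ENNReal.add_lt_top.2 ⟨ENNReal.mul_lt_top ENNReal.ofReal_lt_top hΩv.lt_top,
      ENNReal.mul_lt_top (ENNReal.mul_lt_top hC₁.lt_top ENNReal.ofReal_lt_top) ?_⟩
    exact (upperGag_le hΩm hM (hB n)).trans_lt ENNReal.ofReal_lt_top
  have hLp : CauchySeq fun n => (hmem n).toLp := by
    refine Metric.cauchySeq_iff.2 fun ε hε => ?_
    obtain ⟨e, he, h⟩ := exists_lintegral_abs_le_real hN hΩm hR hΩ hp hM hs hq
      (half_pos hε)
    obtain ⟨n₀, hn₀⟩ := hcauchy e he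
    refine ⟨n₀, fun m hm n hn => ?_⟩
    have h1 := h _ (u m - u n).1.measurable (u m - u n).2.2
      (upperGag_le hΩm hM (hn₀ m hm n hn))
    have h2 : edist (hmem m).toLp (hmem n).toLp ≤ ENNReal.ofReal (ε / 2) := by
      rw [Lp.edist_toLp_toLp, eLpNorm_congr_ae (AEEqFun.coeFn_sub (u m).1 (u n).1).symm, hnorm]
      exact h1
    rw [dist_edist]
    exact (ENNReal.toReal_le_of_le_ofReal (by positivity) h2).trans_lt (by linarith)
  obtain ⟨w, hw⟩ := cauchySeq_tendsto_of_complete hLp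
  obtain ⟨φ, hφ, hlim⟩ := (tendstoInMeasure_of_tendsto_Lp hw).exists_seq_tendsto_ae
  have hlim' : ∀ᵐ x, Tendsto (fun k => (u (φ k) : Eucl N →ₘ[volume] ℝ) x) atTop
      (𝓝 ((w : Eucl N →ₘ[volume] ℝ) x)) := by
    filter_upwards [hlim, ae_all_iff.2 fun n => (hmem n).coeFn_toLp] with x h1 h2
    simpa only [h2] using h1
  refine ⟨⟨(w : Eucl N →ₘ[volume] ℝ), mem_X0_of_ae_tendsto hlim' (fun k => (hbd _).1)
    fun k => (hbd _).2⟩, φ, hφ, ?_⟩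
  filter_upwards [ae_pair_pairMeasure hlim'] with z hz
  exact hz.1.sub hz.2

lemma eq_zero_of_pairDiff_ae_eq_zero (hN : N ≠ 0) (hΩm : MeasurableSet Ω) (hR : 0 < R)
    (hΩ : Ω ⊆ Metric.ball 0 R) (hM : ∀ x y, p x y ≤ M) (hs : 0 < s)
    (hq : ∀ x ∈ Metric.closedBall 0 (R + 2), ∀ y ∈ Metric.closedBall 0 (R + 2), q ≤ p x y)
    (u : X0 Ω s hp) (hu : ∀ᵐ z ∂pairMeasure s p, pairDiff u z = 0) : u = 0 := by
  have h0 : upperGag q s p (u : Eucl N →ₘ[volume] ℝ) = 0 := by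
    rw [← ofReal_upperModular hΩm hM, upperModular, integral_eq_zero_of_ae]
    · simp
    · filter_upwards [ae_restrict_of_ae hu] with z hz
      have := hp.one_lt z.1 z.2
      rw [hz, abs_zero, Real.zero_rpow (by linarith), Pi.zero_apply]
  have h1 : ∫⁻ x, ENNReal.ofReal |(u : Eucl N →ₘ[volume] ℝ) x| = 0 := by
    by_contra hne
    obtain ⟨δ, hδ, hδ'⟩ := ENNReal.lt_iff_exists_nnreal_btwn.1 (pos_iff_ne_zero.2 hne)
    have hδ0 : (0 : ℝ) < δ := by exact_mod_cast hδ
    obtain ⟨e, -, h⟩ := exists_lintegral_abs_le_real hN hΩm hR hΩ hp hM hs hq hδ0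
    have := h _ u.1.measurable u.2.2 (by rw [h0]; exact zero_le)
    rw [ENNReal.ofReal_coe_nnreal] at this
    exact absurd hδ' (not_lt.2 this)
  have hm : Measurable fun x => ENNReal.ofReal |(u : Eucl N →ₘ[volume] ℝ) x| :=
    (measurable_norm.comp u.1.measurable).ennreal_ofReal
  rw [lintegral_eq_zero_iff hm] at h1
  refine Subtype.ext (AEEqFun.ext ?_)
  filter_upwards [h1, AEEqFun.coeFn_zero (α := Eucl N) (β := ℝ) (μ := volume)] with x hx hx0
  rw [Submodule.coe_zero, hx0]
  simpa using hx

lemma weakIntegrand_eq (u φ : X0 Ω s hp) (z : Eucl N × Eucl N) :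
    weakIntegrand s p (u : Eucl N →ₘ[volume] ℝ) (φ : Eucl N →ₘ[volume] ℝ) z =
      (ENNReal.ofReal (singularKernel s p z.1 z.2)).toReal •
        (|pairDiff u z| ^ (p z.1 z.2 - 2) * pairDiff u z * pairDiff φ z) := by
  have h0 : 0 ≤ singularKernel s p z.1 z.2 := Real.rpow_nonneg (norm_nonneg _) _
  rw [ENNReal.toReal_ofReal h0, singularKernel,
    Real.rpow_neg (norm_nonneg _), smul_eq_mul, inv_mul_eq_div]
  rfl

/-- With the kernel absorbed into the measure, the weak equation becomes the one solved by
`ModularSystem.existsUnique`. -/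
lemma isWeakSolution_iff (f : X0 Ω s hp →ₗ[ℝ] ℝ) (u : X0 Ω s hp) :
    IsWeakSolution f u ↔ ∀ φ : X0 Ω s hp,
      Integrable (fun z => |pairDiff u z| ^ (p z.1 z.2 - 2) * pairDiff u z * pairDiff φ z)
        (pairMeasure s p) ∧
      ∫ z, |pairDiff u z| ^ (p z.1 z.2 - 2) * pairDiff u z * pairDiff φ z ∂pairMeasure s p
        = f φ := by
  have hm := (singularKernel_measurable hp s).ennreal_ofReal
  have hlt : ∀ᵐ z ∂(volume : Measure (Eucl N × Eucl N)),
      ENNReal.ofReal (singularKernel s p z.1 z.2) < ⊤ :=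
    Eventually.of_forall fun _ => ENNReal.ofReal_lt_top
  refine forall_congr' fun φ => ?_
  rw [funext (weakIntegrand_eq u φ), pairMeasure,
    integrable_withDensity_iff_integrable_smul' hm hlt,
    integral_withDensity_eq_integral_toReal_smul hm hlt]

end

end FracVarExp

/-! ### The existence and uniqueness theorem -/

theorem corollary5p3 {N : ℕ} (Ω : Set (FracVarExp.Eucl N)) (hΩo : IsOpen Ω)
    (hΩb : Bornology.IsBounded Ω) (s : ℝ) (hs0 : 0 < s) (hs1 : s < 1)
    (p : FracVarExp.Eucl N → FracVarExp.Eucl N → ℝ) (hp : FracVarExp.IsVariableExponent p)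
    (hsp : s * FracVarExp.pPlus Ω p < (N : ℝ))
    (f : FracVarExp.X0 Ω s hp →ₗ[ℝ] ℝ) (hf : FracVarExp.IsDual f) :
    ∃! u : FracVarExp.X0 Ω s hp, FracVarExp.IsWeakSolution f u := by
  -- For `N = 0` the hypothesis `s p⁺ < N` would contradict `p⁺ ≥ 0`.
  have hN : N ≠ 0 := by
    rintro rfl
    have h0 : 0 ≤ FracVarExp.pPlus Ω p := by
      refine Real.sSup_nonneg ?_
      rintro _ ⟨z, -, rfl⟩
      linarith [hp.one_lt z.1 z.2]
    have := mul_nonneg hs0.le h0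
    rw [Nat.cast_zero] at hsp
    linarith
  have hΩm := hΩo.measurableSet
  obtain ⟨M, hM⟩ := hp.bounded
  obtain ⟨R, hR, hΩ⟩ := hΩb.subset_ball_lt 0 0
  have hcpt : IsCompact (Metric.closedBall (0 : FracVarExp.Eucl N) (R + 2) ×ˢ
      Metric.closedBall (0 : FracVarExp.Eucl N) (R + 2)) :=
    (isCompact_closedBall _ _).prod (isCompact_closedBall _ _)
  have h0 : (0 : FracVarExp.Eucl N) ∈ Metric.closedBall (0 : FracVarExp.Eucl N) (R + 2) :=
    Metric.mem_closedBall_self (by linarith)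
  -- The minimum is attained by compactness, hence `q > 1`, although the infimum of `p` over all
  -- pairs may be `1`.
  obtain ⟨z₀, -, hmin⟩ := hcpt.exists_isMinOn ⟨(0, 0), h0, h0⟩ hp.continuous.continuousOn
  set q := p z₀.1 z₀.2 with hqdef
  have hq : ∀ x ∈ Metric.closedBall 0 (R + 2), ∀ y ∈ Metric.closedBall 0 (R + 2), q ≤ p x y :=
    fun x hx y hy => hmin (mk_mem_prod hx hy)
  obtain ⟨C, hC, hmod⟩ := FracVarExp.exists_modular_bound hN hΩm hR hΩ hp hM hs0 hq 1
  obtain ⟨A, hA⟩ := hf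
  -- Upper modular at most `1` bounds both full modulars by `C`, hence the norm by `2C`, so
  -- boundedness of `f` in norm becomes boundedness on the modular unit ball.
  have hbound : ∀ u, FracVarExp.upperModular (FracVarExp.pairMeasure s p) FracVarExp.pairDiff
      (fun z => p z.1 z.2) q u ≤ 1 → |f u| ≤ |A| * (C + C) := fun u hu => by
    obtain ⟨h1, h2⟩ := hmod _ u.1.measurable u.2.2 (FracVarExp.upperGag_le hΩm hM hu)
    refine (hA u).trans ?_
    exact mul_le_mul (le_abs_self A) (FracVarExp.normK_le hp hC h1 h2)
      (FracVarExp.normK_nonneg _ _) (abs_nonneg A)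
  simp only [FracVarExp.isWeakSolution_iff]
  exact (FracVarExp.modularSystem hΩm hM).existsUnique (hp.one_lt _ _) (hM _ _) hbound
    (FracVarExp.isComplete_pairDiff hN hΩm hR hΩ hM hs0 hq)
    (FracVarExp.eq_zero_of_pairDiff_ae_eq_zero hN hΩm hR hΩ hM hs0 hq)
end
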